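/- Let $G=G_{4,2}(\mathbb R)$ be the Grassmann manifold of $2$-planes in $\mathbb R^4$, let $\mathbb Z_2^4=\{\pm1\}^4$ act on $G$ by changes of signs of the coordinates, and let $\pi:G\to X=G/\mathbb Z_2^4$ be the projection. Give $X$ the quotient topology and the functional structure induced from $G$: a continuous real function $f$ on an open set $U\subseteq X$ is called smooth iff $f\circ\pi$ is smooth on $\pi^{-1}(U)$. A point $q\in X$ is a *smooth point of dimension $d$* if some open neighbourhood of $q$ is isomorphic, by a homeomorphism that identifies the smooth functions on corresponding open sets, to an open subset of $\mathbb R^d$ with its $C^\infty$ functions; it is *singular* if it is not a smooth point of any dimension. For $n=2,3,4$ let $H_n\cong\mathbb Z_2^{n-1}$ be the group of all $\varepsilon\in\{\pm1\}^n$ with $\varepsilon_1\cdots\varepsilon_n=1$, acting on $\mathbb R^n$ and on $S^{n-1}$ by changes of signs; for $n=2$ this is $\{\pm1\}$, so $S^1/H_2=\mathbb RP^1$. Let $D^m$ be the open unit disc in $\mathbb R^m$, and let $\mathrm{cone}(S^{n-1}/H_n)$ be the open cone $[0,\infty)\times (S^{n-1}/H_n)$ with $\{0\}\times (S^{n-1}/H_n)$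 collapsed to the apex. A continuous function on an open subset of $D^m\times\mathrm{cone}(S^{n-1}/H_n)$ is called smooth iff its pull-back under $(v,x)\mapsto (v,[\|x\|,[x/\|x\|]])$ is smooth on the corresponding open subset of $D^m\times\mathbb R^n$ (that is, the cone carries the structure of $\mathbb R^n/H_n$). **Theorem.** Every fibre $\pi^{-1}(q)$ has $2^k$ elements for some $0\le k\le 3$. 1. If $|\pi^{-1}(q)|=8$, then $q$ is a smooth point of dimension $4$. 2. If $|\pi^{-1}(q)|=2^k$ with $0\le k\le 2$, then $q$ is singular, and $q$ has an open neighbourhood isomorphic, with its smooth functions, to * $D^2\times\mathrm{cone}(\mathbb RP^1)$ if $|\pi^{-1}(q)|=4$, * $D^1\times\mathrm{cone}(S^2/\mathbb Z_2^2)$ if $|\pi^{-1}(q)|=2$, where $\mathbb Z_2^2=H_3$, * $\mathrm{cone}(S^3/\mathbb Z_2^3)$ if $|\pi^{-1}(q)|=1$, where $\mathbb Z_2^3=H_4$, by an isomorphism that takes $q$ to $(0,\text{apex})$ (to the apex in the last case). The groups and actions are those induced by the stabilizers: with $(m,n)=(2,2),(1,3),(0,4)$ in the three cases and any $p\in\pi^{-1}(q)$,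 the stabilizer of $p$ modulo $\{\pm1\}$ (which acts trivially on $G$) is isomorphic to $H_n$, and its representation on $T_pG$ by the differentials at $p$ is isomorphic to the sum of the trivial representation on $\mathbb R^m$ and of the representation of $H_n$ on $\mathbb R^n$. 3. The actions of $H_3=\mathbb Z_2^2$ on $S^2$ and of $H_4=\mathbb Z_2^3$ on $S^3$ have no point fixed by the whole group. 4. Consequently the smooth structure of $G$ does not induce a smooth structure on $X$ (a space homeomorphic to $S^4$): there are no smooth manifold $N$ (in particular no $4$-sphere with any smooth structure) and homeomorphism $h:X\to N$ such that $h\circ\pi:G\to N$ is a smooth map that induces the smooth structure of $N$, i.e. such that $h\circ\pi$ is smooth and every function $f$ on an open set $V\subseteq N$ for which $f\circ h\circ\pi$ is smooth on $(h\circ\pi)^{-1}(V)$ is itself smooth on $V$. -/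

import Mathlib

open scoped Manifold ContDiff

noncomputable section

/-! ## Functional structures -/

/-- A (smooth) functional structure on a topological space: for every open set `U` an algebra of
continuous real functions on `U`, closed under restriction and under gluing.  A function on `U` is
represented by a total function, of which only the values on `U` matter (`congr`). -/
structure FunctionalStructure (X : Type) [TopologicalSpace X] where
  /-- `f` restricted to `U` belongs to the structure. -/
  IsSmooth : TopologicalSpace.Opens X → (X → ℝ) → Prop
  continuousOn : ∀ {U f}, IsSmooth U f → ContinuousOn f U
  congr : ∀ {U f g}, IsSmooth U f → Set.EqOn f g U → IsSmooth U g
  const : ∀ U (c : ℝ), IsSmooth U (fun _ => c)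
  add : ∀ {U f g}, IsSmooth U f → IsSmooth U g → IsSmooth U (fun x => f x + g x)
  mul : ∀ {U f g}, IsSmooth U f → IsSmooth U g → IsSmooth U (fun x => f x * g x)
  restrict : ∀ {U V f}, V ≤ U → IsSmooth U f → IsSmooth V f
  glue : ∀ {ι : Type} (U : ι → TopologicalSpace.Opens X) {f},
    (∀ i, IsSmooth (U i) f) → IsSmooth (⨆ i, U i) f

namespace FunctionalStructure

/-- The functional structure of a manifold: smooth real functions on open sets. -/
def ofManifold {E H M : Type} [NormedAddCommGroup E] [NormedSpace ℝ E] [TopologicalSpace H]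
    (I : ModelWithCorners ℝ E H) [TopologicalSpace M] [ChartedSpace H M] :
    FunctionalStructure M where
  IsSmooth U f := ContMDiffOn I 𝓘(ℝ, ℝ) ∞ f U
  continuousOn h := h.continuousOn
  congr h hfg := h.congr fun x hx => (hfg hx).symm
  const U c := contMDiffOn_const
  add hf hg := hf.add hg
  mul hf hg := hf.mul hg
  restrict hVU h := h.mono hVU
  glue U f h := by
    intro x hx
    obtain ⟨i, hi⟩ := TopologicalSpace.Opens.mem_iSup.1 hx
    exact ((h i).contMDiffAt ((U i).isOpen.mem_nhds hi)).contMDiffWithinAt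

/-- Push-forward of a functional structure along a continuous map `c`: a continuous function `f`
on `V` belongs to it iff `f ∘ c` belongs to the given structure on `c⁻¹(V)`. -/
def pushforward {X Y : Type} [TopologicalSpace X] [TopologicalSpace Y]
    (F : FunctionalStructure X) (c : C(X, Y)) : FunctionalStructure Y where
  IsSmooth V f := ContinuousOn f V ∧ F.IsSmooth (V.comap c) (f ∘ c)
  continuousOn h := h.1
  congr h hfg := ⟨h.1.congr fun x hx => (hfg hx).symm, F.congr h.2 fun _ hx => hfg hx⟩
  const V r := ⟨continuousOn_const, F.const _ r⟩
  add hf hg := ⟨hf.1.add hg.1, F.add hf.2 hg.2⟩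
  mul hf hg := ⟨hf.1.mul hg.1, F.mul hf.2 hg.2⟩
  restrict hVU h := ⟨h.1.mono hVU, F.restrict (fun _ hx => hVU hx) h.2⟩
  glue U f h := by
    refine ⟨fun x hx => ?_, ?_⟩
    · obtain ⟨i, hi⟩ := TopologicalSpace.Opens.mem_iSup.1 hx
      exact ((h i).1.continuousAt ((U i).isOpen.mem_nhds hi)).continuousWithinAt
    · have hU : TopologicalSpace.Opens.comap c (⨆ i, U i) = ⨆ i, (U i).comap c := by
        ext x
        simp
      rw [hU]
      exact F.glue _ fun i => (h i).2

/-- The homeomorphism `e`, from the open set `e.source` onto the open set `e.target`, is an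
isomorphism between the restrictions of the functional structures to these open sets. -/
def IsLocalIso {X Y : Type} [TopologicalSpace X] [TopologicalSpace Y]
    (F : FunctionalStructure X) (G : FunctionalStructure Y) (e : OpenPartialHomeomorph X Y) :
    Prop :=
  ∀ (V : TopologicalSpace.Opens Y) (f : Y → ℝ), (V : Set Y) ⊆ e.target →
    (G.IsSmooth V f ↔ F.IsSmooth ⟨e.source ∩ e ⁻¹' V, e.isOpen_inter_preimage V.isOpen⟩ (f ∘ e))

/-- `q` is a smooth point of dimension `d`: some open neighbourhood of `q` is, with its functional
structure, isomorphic to an open subset of `ℝ^d` with its smooth functions. -/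
def IsSmoothPoint {X : Type} [TopologicalSpace X] (F : FunctionalStructure X) (d : ℕ) (q : X) :
    Prop :=
  ∃ e : OpenPartialHomeomorph X (EuclideanSpace ℝ (Fin d)),
    q ∈ e.source ∧ F.IsLocalIso (ofManifold 𝓘(ℝ, EuclideanSpace ℝ (Fin d))) e

/-- `q` is a singular point: it is not a smooth point, of any dimension. -/
def IsSingularPoint {X : Type} [TopologicalSpace X] (F : FunctionalStructure X) (q : X) : Prop :=
  ∀ d : ℕ, ¬ F.IsSmoothPoint d q

/-- `q` has an open neighbourhood isomorphic, with its functional structure, to the whole space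
`Y` with the functional structure `G`, by an isomorphism that takes `q` to `y`. -/
def HasNeighbourhoodOfForm {X Y : Type} [TopologicalSpace X] [TopologicalSpace Y]
    (F : FunctionalStructure X) (q : X) (G : FunctionalStructure Y) (y : Y) : Prop :=
  ∃ e : OpenPartialHomeomorph X Y,
    q ∈ e.source ∧ e.target = Set.univ ∧ e q = y ∧ F.IsLocalIso G e

end FunctionalStructure

/-! ## The real Grassmann manifold of 2-planes in `ℝ⁴` -/

/-- The set of 2-dimensional linear subspaces of `ℝ⁴`. -/
def Gr42 : Type := {V : Submodule ℝ (Fin 4 → ℝ) // Module.finrank ℝ V = 2}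

namespace Gr42

/-- Frames: `4 × 2` matrices with linearly independent columns. -/
abbrev Frame : Type := {M : Matrix (Fin 4) (Fin 2) ℝ // Function.Injective M.mulVec}

/-- The plane spanned by the columns of a frame. -/
def plane (M : Frame) : Gr42 :=
  ⟨LinearMap.range M.1.mulVecLin, by
    rw [LinearMap.finrank_range_of_inj (f := M.1.mulVecLin) M.2]
    simp⟩

/-- The topology of the Grassmannian is the quotient topology from the space of frames. -/
instance : TopologicalSpace Gr42 := TopologicalSpace.coinduced plane inferInstance

theorem plane_surjective : Function.Surjective plane := by
  rintro ⟨V, hV⟩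
  let b : Module.Basis (Fin 2) ℝ V := Module.finBasisOfFinrankEq ℝ V hV
  let M : Matrix (Fin 4) (Fin 2) ℝ := Matrix.of fun i j => (b j : Fin 4 → ℝ) i
  have hM : M.mulVecLin = V.subtype ∘ₗ b.equivFun.symm.toLinearMap := by
    apply LinearMap.ext
    intro v
    ext i
    simp [M, Matrix.mulVec, dotProduct, Module.Basis.equivFun_symm_apply, mul_comm]
  refine ⟨⟨M, ?_⟩, ?_⟩
  · have : Function.Injective M.mulVecLin := by
      rw [hM]
      exact V.injective_subtype.comp b.equivFun.symm.injective
    exact this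
  · apply Subtype.ext
    change LinearMap.range M.mulVecLin = V
    rw [hM, LinearMap.range_comp, LinearEquiv.range, Submodule.map_top, Submodule.range_subtype]

theorem isQuotientMap_plane : Topology.IsQuotientMap plane := ⟨⟨rfl⟩, plane_surjective⟩

theorem exists_mul_of_plane_eq {M N : Frame} (h : plane M = plane N) :
    ∃ g : Matrix (Fin 2) (Fin 2) ℝ, IsUnit g.det ∧ N.1 = M.1 * g := by
  have key : ∀ {A B : Frame}, plane A = plane B →
      ∃ g : Matrix (Fin 2) (Fin 2) ℝ, B.1 = A.1 * g := by
    intro A B hAB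
    have hr : LinearMap.range A.1.mulVecLin = LinearMap.range B.1.mulVecLin :=
      congrArg Subtype.val hAB
    have hc : ∀ j, ∃ w, A.1.mulVec w = B.1.col j := by
      intro j
      have : B.1.col j ∈ LinearMap.range B.1.mulVecLin := ⟨Pi.single j 1, by simp⟩
      rw [← hr] at this
      simpa using this
    choose w hw using hc
    refine ⟨Matrix.of fun i j => w j i, ?_⟩
    ext i j
    exact (congrFun (hw j) i).symm
  obtain ⟨g, hg⟩ := key h
  obtain ⟨g', hg'⟩ := key h.symm
  refine ⟨g, ?_, hg⟩
  have h1 : g * g' = 1 := by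
    have h2 : M.1 * (g * g') = M.1 := by rw [← Matrix.mul_assoc, ← hg, ← hg']
    ext i j
    have h3 : (g * g').mulVec (Pi.single j 1) = (1 : Matrix (Fin 2) (Fin 2) ℝ).mulVec
        (Pi.single j 1) := by
      apply M.2
      rw [Matrix.mulVec_mulVec, h2, Matrix.one_mulVec]
    simpa using congrFun h3 i
  exact (Matrix.isUnit_iff_isUnit_det g).1 (IsUnit.of_mul_eq_one g' h1)

/-- The model vector space of the charts, with the entries of a `2 × 2` matrix as coordinates. -/
abbrev Model : Type := Fin 2 → Fin 2 → ℝ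

/-- The `2 × 2` submatrix of the first two of the four rows, as they are ordered by `e`. -/
def top (e : Fin 2 ⊕ Fin 2 ≃ Fin 4) (M : Matrix (Fin 4) (Fin 2) ℝ) : Matrix (Fin 2) (Fin 2) ℝ :=
  M.submatrix (fun i => e (Sum.inl i)) id

/-- The `2 × 2` submatrix of the last two of the four rows, as they are ordered by `e`. -/
def bot (e : Fin 2 ⊕ Fin 2 ≃ Fin 4) (M : Matrix (Fin 4) (Fin 2) ℝ) : Matrix (Fin 2) (Fin 2) ℝ :=
  M.submatrix (fun i => e (Sum.inr i)) id

/-- Local coordinates: normalise the frame so that its `top` block is the identity matrix, and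
read off the `bot` block. -/
def coord (e : Fin 2 ⊕ Fin 2 ≃ Fin 4) (M : Matrix (Fin 4) (Fin 2) ℝ) : Model :=
  bot e M * (top e M)⁻¹

/-- The matrix whose `top` block is the identity and whose `bot` block is `A`. -/
def graphMatrix (e : Fin 2 ⊕ Fin 2 ≃ Fin 4) (A : Model) : Matrix (Fin 4) (Fin 2) ℝ :=
  Matrix.of fun i => Sum.elim (1 : Matrix (Fin 2) (Fin 2) ℝ) A (e.symm i)

theorem top_mul (e : Fin 2 ⊕ Fin 2 ≃ Fin 4) (M : Matrix (Fin 4) (Fin 2) ℝ)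
    (g : Matrix (Fin 2) (Fin 2) ℝ) : top e (M * g) = top e M * g := rfl

theorem bot_mul (e : Fin 2 ⊕ Fin 2 ≃ Fin 4) (M : Matrix (Fin 4) (Fin 2) ℝ)
    (g : Matrix (Fin 2) (Fin 2) ℝ) : bot e (M * g) = bot e M * g := rfl

theorem ext_top_bot (e : Fin 2 ⊕ Fin 2 ≃ Fin 4) {M N : Matrix (Fin 4) (Fin 2) ℝ}
    (ht : top e M = top e N) (hb : bot e M = bot e N) : M = N := by
  ext i j
  obtain ⟨k, rfl⟩ := e.surjective i
  rcases k with k | k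
  · exact congrFun (congrFun ht k) j
  · exact congrFun (congrFun hb k) j

@[simp] theorem top_graphMatrix (e : Fin 2 ⊕ Fin 2 ≃ Fin 4) (A : Model) :
    top e (graphMatrix e A) = 1 := by
  ext i j
  simp only [top, graphMatrix, Matrix.submatrix_apply, Matrix.of_apply, Equiv.symm_apply_apply]
  rfl

@[simp] theorem bot_graphMatrix (e : Fin 2 ⊕ Fin 2 ≃ Fin 4) (A : Model) :
    bot e (graphMatrix e A) = Matrix.of A := by
  ext i j
  simp only [bot, graphMatrix, Matrix.submatrix_apply, Matrix.of_apply, Equiv.symm_apply_apply]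
  rfl

theorem injective_of_top (e : Fin 2 ⊕ Fin 2 ≃ Fin 4) {M : Matrix (Fin 4) (Fin 2) ℝ}
    (h : (top e M).det ≠ 0) : Function.Injective M.mulVec := by
  intro v w hvw
  have h1 : (top e M).mulVec v = (top e M).mulVec w := by
    ext i
    exact congrFun hvw (e (Sum.inl i))
  have h2 : Function.Injective (top e M).mulVec :=
    Matrix.mulVec_injective_iff_isUnit.2 ((Matrix.isUnit_iff_isUnit_det _).2 h.isUnit)
  exact h2 h1

/-- The frame with `top` block the identity and `bot` block `A`. -/
def graphFrame (e : Fin 2 ⊕ Fin 2 ≃ Fin 4) (A : Model) : Frame :=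
  ⟨graphMatrix e A, injective_of_top e (by simp)⟩

/-- Some frame of a plane. -/
def frameOf (p : Gr42) : Frame := Function.surjInv plane_surjective p

@[simp] theorem plane_frameOf (p : Gr42) : plane (frameOf p) = p :=
  Function.surjInv_eq plane_surjective p

theorem top_ne_iff (e : Fin 2 ⊕ Fin 2 ≃ Fin 4) {M N : Frame} (h : plane M = plane N) :
    (top e M.1).det ≠ 0 ↔ (top e N.1).det ≠ 0 := by
  obtain ⟨g, hg, hN⟩ := exists_mul_of_plane_eq h
  rw [hN, top_mul, Matrix.det_mul, mul_ne_zero_iff]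
  exact ⟨fun h => ⟨h, hg.ne_zero⟩, fun h => h.1⟩

theorem coord_eq (e : Fin 2 ⊕ Fin 2 ≃ Fin 4) {M N : Frame} (h : plane M = plane N) :
    coord e M.1 = coord e N.1 := by
  obtain ⟨g, hg, hN⟩ := exists_mul_of_plane_eq h
  unfold coord
  rw [hN, top_mul, bot_mul, Matrix.mul_inv_rev, Matrix.mul_assoc,
    Matrix.mul_nonsing_inv_cancel_left g _ hg]

theorem plane_graphFrame_coord (e : Fin 2 ⊕ Fin 2 ≃ Fin 4) {M : Frame}
    (h : (top e M.1).det ≠ 0) : plane (graphFrame e (coord e M.1)) = plane M := by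
  have hM : M.1 = (graphFrame e (coord e M.1)).1 * top e M.1 := by
    apply ext_top_bot e
    · rw [top_mul]
      simp [graphFrame]
    · rw [bot_mul]
      change _ = bot e (graphMatrix e _) * _
      rw [bot_graphMatrix]
      change _ = bot e M.1 * (top e M.1)⁻¹ * top e M.1
      rw [Matrix.nonsing_inv_mul_cancel_right _ _ h.isUnit]
  have hu : IsUnit (top e M.1) := (Matrix.isUnit_iff_isUnit_det _).2 h.isUnit
  apply Subtype.ext
  change LinearMap.range (graphFrame e (coord e M.1)).1.mulVecLin = LinearMap.range M.1.mulVecLin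
  conv_rhs => rw [hM, Matrix.mulVecLin_mul, LinearMap.range_comp]
  have ht : LinearMap.range (top e M.1).mulVecLin = ⊤ :=
    LinearMap.range_eq_top.2 (Matrix.mulVec_surjective_iff_isUnit.2 hu)
  rw [ht, Submodule.map_top]

theorem continuous_top (e : Fin 2 ⊕ Fin 2 ≃ Fin 4) : Continuous (top e) :=
  continuous_id.matrix_submatrix _ _

theorem continuous_bot (e : Fin 2 ⊕ Fin 2 ≃ Fin 4) : Continuous (bot e) :=
  continuous_id.matrix_submatrix _ _

theorem coord_apply (e : Fin 2 ⊕ Fin 2 ≃ Fin 4) (M : Matrix (Fin 4) (Fin 2) ℝ) (i j : Fin 2) :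
    coord e M i j = (top e M).det⁻¹ * (bot e M * (top e M).adjugate) i j := by
  change (bot e M * (top e M)⁻¹) i j = _
  rw [Matrix.inv_def, Ring.inverse_eq_inv', Matrix.mul_smul]
  rfl

theorem isOpen_top_ne (e : Fin 2 ⊕ Fin 2 ≃ Fin 4) : IsOpen {M : Frame | (top e M.1).det ≠ 0} :=
  isOpen_ne.preimage ((continuous_top e).comp continuous_subtype_val).matrix_det

theorem isOpen_source (e : Fin 2 ⊕ Fin 2 ≃ Fin 4) :
    IsOpen {p : Gr42 | (top e (frameOf p).1).det ≠ 0} := by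
  rw [← isQuotientMap_plane.isOpen_preimage]
  convert isOpen_top_ne e using 1
  ext M
  exact top_ne_iff e (plane_frameOf (plane M))

/-- The standard chart of the Grassmannian for an ordering `e` of the four coordinates: its domain
is the set of planes whose Plücker coordinate for the first two of them is not zero. -/
def chart (e : Fin 2 ⊕ Fin 2 ≃ Fin 4) : OpenPartialHomeomorph Gr42 Model where
  toFun p := coord e (frameOf p).1
  invFun A := plane (graphFrame e A)
  source := {p | (top e (frameOf p).1).det ≠ 0}
  target := Set.univ
  map_source' _ _ := Set.mem_univ _
  map_target' A _ := by
    have := (top_ne_iff e (plane_frameOf (plane (graphFrame e A)))).2 (by simp [graphFrame])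
    exact this
  left_inv' p hp := by
    change (top e (frameOf p).1).det ≠ 0 at hp
    rw [plane_graphFrame_coord e hp, plane_frameOf]
  right_inv' A _ := by
    rw [coord_eq e (plane_frameOf (plane (graphFrame e A)))]
    change bot e (graphMatrix e A) * (top e (graphMatrix e A))⁻¹ = A
    simp
    rfl
  open_source := isOpen_source e
  open_target := isOpen_univ
  continuousOn_toFun := by
    refine (isQuotientMap_plane.continuousOn_isOpen_iff
      (g := fun p => coord e (frameOf p).1) (isOpen_source e)).2 ?_
    have h : ContinuousOn (fun M : Frame => coord e M.1) {M : Frame | (top e M.1).det ≠ 0} := by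
      refine continuousOn_pi.2 fun i => continuousOn_pi.2 fun j => ?_
      simp only [coord_apply]
      have ht : Continuous fun M : Frame => top e M.1 :=
        (continuous_top e).comp continuous_subtype_val
      have hb : Continuous fun M : Frame => bot e M.1 :=
        (continuous_bot e).comp continuous_subtype_val
      exact (ht.matrix_det.continuousOn.inv₀ fun M hM => hM).mul
        ((hb.matrix_mul ht.matrix_adjugate).matrix_elem i j).continuousOn
    refine (h.congr fun M _ => coord_eq e (plane_frameOf (plane M))).mono fun M hM => ?_
    exact (top_ne_iff e (plane_frameOf (plane M))).1 hM
  continuousOn_invFun := by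
    apply Continuous.continuousOn
    refine isQuotientMap_plane.continuous.comp (Continuous.subtype_mk ?_ _)
    refine continuous_matrix fun i j => ?_
    obtain ⟨k, rfl⟩ := e.surjective i
    rcases k with k | k
    · simp only [graphMatrix, Matrix.of_apply, Equiv.symm_apply_apply]
      exact continuous_const
    · simp only [graphMatrix, Matrix.of_apply, Equiv.symm_apply_apply]
      exact continuous_apply_apply k j

/-- The chart in terms of an arbitrary frame. -/
theorem chart_plane (e : Fin 2 ⊕ Fin 2 ≃ Fin 4) (M : Frame) :
    chart e (plane M) = coord e M.1 :=
  coord_eq e (plane_frameOf (plane M))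

theorem mem_chart_source (e : Fin 2 ⊕ Fin 2 ≃ Fin 4) (M : Frame) :
    plane M ∈ (chart e).source ↔ (top e M.1).det ≠ 0 :=
  top_ne_iff e (plane_frameOf (plane M))

theorem exists_minor (M : Frame) : ∃ i j, M.1 i 0 * M.1 j 1 - M.1 i 1 * M.1 j 0 ≠ 0 := by
  by_contra! h
  have h1 : ∀ i, M.1 i = 0 := by
    intro i
    have hv : M.1.mulVec ![-M.1 i 1, M.1 i 0] = M.1.mulVec 0 := by
      ext j
      have := h i j
      simp only [Matrix.mulVec, dotProduct, Fin.sum_univ_two, Matrix.cons_val_zero,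
        Matrix.cons_val_one, Pi.zero_apply]
      linarith
    have h2 := M.2 hv
    ext k
    fin_cases k
    · simpa using congrFun h2 1
    · simpa using congrFun h2 0
  have h2 : M.1.mulVec ![1, 0] = M.1.mulVec 0 := by
    ext j
    simp [Matrix.mulVec, h1 j]
  simpa using congrFun (M.2 h2) 0

theorem exists_perm : ∀ i j : Fin 4, i ≠ j → ∃ s : Equiv.Perm (Fin 4), s 0 = i ∧ s 1 = j := by
  decide

theorem exists_chart (p : Gr42) : ∃ e, p ∈ (chart e).source := by
  obtain ⟨M, rfl⟩ := plane_surjective p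
  obtain ⟨i, j, hij⟩ := exists_minor M
  have hne : i ≠ j := by
    rintro rfl
    exact hij (by ring)
  obtain ⟨s, rfl, rfl⟩ := exists_perm i j hne
  refine ⟨finSumFinEquiv.trans s, (mem_chart_source _ M).2 ?_⟩
  rw [Matrix.det_fin_two]
  exact hij

/-- The standard atlas of the Grassmannian. -/
instance : ChartedSpace Model Gr42 where
  atlas := Set.range chart
  chartAt p := chart (exists_chart p).choose
  mem_chart_source p := (exists_chart p).choose_spec
  chart_mem_atlas _ := ⟨_, rfl⟩

theorem contDiff_graphMatrix (e : Fin 2 ⊕ Fin 2 ≃ Fin 4) (i : Fin 4) (j : Fin 2) :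
    ContDiff ℝ ∞ fun A : Model => graphMatrix e A i j := by
  obtain ⟨k, rfl⟩ := e.surjective i
  rcases k with k | k
  · simp only [graphMatrix, Matrix.of_apply, Equiv.symm_apply_apply]
    exact contDiff_const
  · simp only [graphMatrix, Matrix.of_apply, Equiv.symm_apply_apply]
    exact contDiff_apply_apply ℝ ℝ k j

instance : IsManifold 𝓘(ℝ, Model) ∞ Gr42 := by
  apply isManifold_of_contDiffOn
  rintro _ _ ⟨e, rfl⟩ ⟨e', rfl⟩
  have h : ContDiffOn ℝ ∞ (fun A : Model => coord e' (graphMatrix e A))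
      {A | (top e' (graphMatrix e A)).det ≠ 0} := by
    refine contDiffOn_pi.2 fun i => contDiffOn_pi.2 fun j => ?_
    simp only [coord_apply, Matrix.det_fin_two, Matrix.adjugate_fin_two, Matrix.mul_apply,
      Fin.sum_univ_two, top, bot, Matrix.submatrix_apply, id]
    have hc := contDiff_graphMatrix e
    have hdet := ((hc (e' (Sum.inl 0)) 0).mul (hc (e' (Sum.inl 1)) 1)).sub
      ((hc (e' (Sum.inl 0)) 1).mul (hc (e' (Sum.inl 1)) 0))
    refine (hdet.contDiffOn.inv fun A hA => hA).mul (ContDiff.contDiffOn ?_)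
    refine ((hc _ _).mul ?_).add ((hc _ _).mul ?_)
    all_goals
      fin_cases j <;> first | exact hc _ _ | exact (hc _ _).neg
  refine (h.congr fun A _ => ?_).mono fun A hA => ?_
  · exact chart_plane e' (graphFrame e A)
  · have hA' : plane (graphFrame e A) ∈ (chart e').source := by
      simpa [chart] using hA
    exact (mem_chart_source e' (graphFrame e A)).1 hA'

/-! ## The action of `ℤ₂⁴` and the orbit space -/

/-- The group `ℤ₂⁴`, as the group of sign vectors. -/
abbrev Signs : Type := Fin 4 → ℤˣ

/-- A sign vector acts on `ℝ⁴` by changing the signs of the coordinates. -/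
def signMap (g : Signs) : (Fin 4 → ℝ) ≃ₗ[ℝ] (Fin 4 → ℝ) where
  toFun v i := ((g i : ℤ) : ℝ) * v i
  invFun v i := ((g i : ℤ) : ℝ) * v i
  map_add' v w := by
    ext i
    simp [mul_add]
  map_smul' c v := by
    ext i
    simp only [Pi.smul_apply, smul_eq_mul, RingHom.id_apply]
    ring
  left_inv v := by
    ext i
    rcases Int.units_eq_one_or (g i) with h | h <;> simp [h]
  right_inv v := by
    ext i
    rcases Int.units_eq_one_or (g i) with h | h <;> simp [h]

/-- The canonical action of `ℤ₂⁴` on the Grassmannian: `g • V = {g v : v ∈ V}`. -/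
instance : MulAction Signs Gr42 where
  smul g V := ⟨V.1.map (signMap g).toLinearMap, by
    rw [LinearEquiv.finrank_map_eq, V.2]⟩
  one_smul V := by
    apply Subtype.ext
    change V.1.map (signMap 1).toLinearMap = V.1
    have h : (signMap 1).toLinearMap = LinearMap.id := by
      apply LinearMap.ext
      intro v
      ext i
      simp [signMap]
    rw [h, Submodule.map_id]
  mul_smul g h V := by
    apply Subtype.ext
    change V.1.map (signMap (g * h)).toLinearMap =
      (V.1.map (signMap h).toLinearMap).map (signMap g).toLinearMap
    rw [← Submodule.map_comp]
    congr 1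
    apply LinearMap.ext
    intro v
    ext i
    simp [signMap, mul_assoc]

/-- The orbit space of the action of `ℤ₂⁴` on the Grassmannian, with the quotient topology. -/
abbrev OrbitSpace : Type := Quotient (MulAction.orbitRel Signs Gr42)

/-- The natural projection onto the orbit space. -/
def proj : C(Gr42, OrbitSpace) := ⟨Quotient.mk _, continuous_quotient_mk'⟩

/-- The functional structure of the orbit space, induced from the smooth structure of the
Grassmannian: functions are smooth iff their compositions with the projection are. -/
def orbitStructure : FunctionalStructure OrbitSpace :=
  (FunctionalStructure.ofManifold 𝓘(ℝ, Model)).pushforward proj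

/-! ## Cones over quotients of spheres -/

/-- The group of sign vectors with product `1`; it is isomorphic to `ℤ₂^(n-1)`. -/
def evenSigns (n : ℕ) : Subgroup (Fin n → ℤˣ) where
  carrier := {g | ∏ i, g i = 1}
  one_mem' := by simp
  mul_mem' {g h} hg hh := by
    simp only [Set.mem_ofPred_eq] at hg hh ⊢
    simp [Finset.prod_mul_distrib, hg, hh]
  inv_mem' {g} hg := by
    simp only [Set.mem_ofPred_eq] at hg ⊢
    simp [hg]

/-- The unit sphere `S^(n-1)` in `ℝ^n`. -/
abbrev UnitSphere (n : ℕ) : Type := Metric.sphere (0 : EuclideanSpace ℝ (Fin n)) 1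

/-- Sign vectors act linearly on `ℝ^n`. -/
def signVec {n : ℕ} (g : Fin n → ℤˣ) (x : EuclideanSpace ℝ (Fin n)) : EuclideanSpace ℝ (Fin n) :=
  WithLp.toLp 2 fun i => ((g i : ℤ) : ℝ) * x i

theorem norm_signVec {n : ℕ} (g : Fin n → ℤˣ) (x : EuclideanSpace ℝ (Fin n)) :
    ‖signVec g x‖ = ‖x‖ := by
  simp only [signVec, EuclideanSpace.norm_eq]
  congr 1
  refine Finset.sum_congr rfl fun i _ => ?_
  rcases Int.units_eq_one_or (g i) with h | h <;> simp [h]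

/-- The group of sign vectors with product `1` acts on the unit sphere. -/
instance (n : ℕ) : MulAction (evenSigns n) (UnitSphere n) where
  smul g x := ⟨signVec g.1 x.1, by simp [norm_signVec]⟩
  one_smul x := by
    apply Subtype.ext
    ext i
    change (((1 : ℤˣ) : ℤ) : ℝ) * x.1 i = x.1 i
    simp
  mul_smul g h x := by
    apply Subtype.ext
    ext i
    change (((g.1 i * h.1 i : ℤˣ) : ℤ) : ℝ) * x.1 i = ((g.1 i : ℤ) : ℝ) * (((h.1 i : ℤ) : ℝ) * x.1 i)
    push_cast
    ring

/-- The quotient of `S^(n-1)` by the sign vectors with product `1`.  For `n = 2, 3, 4` this is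
`S^1/ℤ₂ = ℝP^1`, where `ℤ₂ = {±1}`, then `S^2/ℤ₂²` and `S^3/ℤ₂³`. -/
abbrev SphereQuotient (n : ℕ) : Type := Quotient (MulAction.orbitRel (evenSigns n) (UnitSphere n))

/-- For `n = 2` the group is `{±1}`, so that `SphereQuotient 2` is `ℝP^1`. -/
theorem mem_evenSigns_two (g : Fin 2 → ℤˣ) : g ∈ evenSigns 2 ↔ g = 1 ∨ g = -1 := by
  change ∏ i, g i = 1 ↔ _
  revert g
  decide

/-- `(s, y)` and `(t, z)` are the same point of the cone. -/
def coneSetoid (Y : Type) : Setoid (NNReal × Y) where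
  r a b := a.1 = b.1 ∧ (a.1 = 0 ∨ a.2 = b.2)
  iseqv :=
    { refl := fun _ => ⟨rfl, Or.inr rfl⟩
      symm := fun {a b} h => ⟨h.1.symm, h.2.imp (fun h0 => h.1 ▸ h0) Eq.symm⟩
      trans := fun {a b c} h k => ⟨h.1.trans k.1, by
        rcases h.2 with h0 | h0
        · exact Or.inl h0
        · exact k.2.imp (fun k0 => h.1.trans k0) (fun k0 => h0.trans k0)⟩ }

/-- The (open) cone over `Y`: the product `[0, ∞) × Y` with `{0} × Y` collapsed to a point. -/
abbrev Cone (Y : Type) : Type := Quotient (coneSetoid Y)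

/-- The point `(t, y)` of the cone. -/
def Cone.mk {Y : Type} (t : NNReal) (y : Y) : Cone Y := Quotient.mk (coneSetoid Y) (t, y)

/-- A point of the sphere; it only serves to write down the apex of the cone. -/
def northPole (n : ℕ) [NeZero n] : UnitSphere n := ⟨EuclideanSpace.single 0 1, by simp⟩

/-- The apex of the cone over the quotient of the sphere. -/
def apex (n : ℕ) [NeZero n] : Cone (SphereQuotient n) := Cone.mk 0 (Quotient.mk _ (northPole n))

open Classical in
/-- The direction `x / ‖x‖` of a vector (any point of the sphere for `x = 0`). -/
def direction {n : ℕ} [NeZero n] (x : EuclideanSpace ℝ (Fin n)) : UnitSphere n :=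
  if h : x = 0 then northPole n
  else ⟨‖x‖⁻¹ • x, by simp [norm_smul, h]⟩

theorem Cone.mk_zero {Y : Type} (y z : Y) : Cone.mk 0 y = Cone.mk 0 z :=
  Quotient.sound ⟨rfl, Or.inl rfl⟩

theorem continuousAt_direction {n : ℕ} [NeZero n] {x : EuclideanSpace ℝ (Fin n)} (hx : x ≠ 0) :
    ContinuousAt direction x := by
  rw [Topology.IsInducing.subtypeVal.continuousAt_iff]
  have h : ContinuousAt (fun y : EuclideanSpace ℝ (Fin n) => ‖y‖⁻¹ • y) x :=
    (continuousAt_id.norm.inv₀ (norm_ne_zero_iff.2 hx)).smul continuousAt_id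
  refine h.congr ?_
  filter_upwards [isOpen_ne.mem_nhds hx] with y hy
  have hy' : y ≠ 0 := hy
  simp [direction, hy']

/-- Polar coordinates `x ↦ (‖x‖, [x/‖x‖])` from `ℝ^n` to the cone over the quotient of the unit
sphere. It identifies the quotient of `ℝ^n` by the group with this cone. -/
def coneMap (n : ℕ) [NeZero n] : C(EuclideanSpace ℝ (Fin n), Cone (SphereQuotient n)) where
  toFun x := Cone.mk ‖x‖₊ (Quotient.mk _ (direction x))
  continuous_toFun := by
    have hmk : Continuous fun a : NNReal × SphereQuotient n => Cone.mk a.1 a.2 :=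
      continuous_quotient_mk'
    rw [continuous_iff_continuousAt]
    intro x
    by_cases hx : x = 0
    · subst hx
      rw [ContinuousAt, tendsto_nhds]
      intro W hW h0
      have hW' := hW.preimage hmk
      have hsub : ({0} : Set NNReal) ×ˢ (Set.univ : Set (SphereQuotient n)) ⊆
          (fun a : NNReal × SphereQuotient n => Cone.mk a.1 a.2) ⁻¹' W := by
        rintro ⟨t, y⟩ ⟨ht, -⟩
        obtain rfl : t = 0 := ht
        change Cone.mk 0 y ∈ W
        have h0' : Cone.mk ‖(0 : EuclideanSpace ℝ (Fin n))‖₊ _ ∈ W := h0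
        rw [nnnorm_zero] at h0'
        rwa [Cone.mk_zero y]
      obtain ⟨u, v, hu, -, hu0, hv, huv⟩ :=
        generalized_tube_lemma isCompact_singleton isCompact_univ hW' hsub
      have : (fun x : EuclideanSpace ℝ (Fin n) => ‖x‖₊) ⁻¹' u ∈
          nhds (0 : EuclideanSpace ℝ (Fin n)) :=
        (hu.preimage continuous_nnnorm).mem_nhds (by simpa using hu0)
      filter_upwards [this] with y hy
      have hmem : ((‖y‖₊, Quotient.mk _ (direction y)) : NNReal × SphereQuotient n) ∈ u ×ˢ v :=
        ⟨hy, hv trivial⟩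
      exact huv hmem
    · have h2 : ContinuousAt (fun y : EuclideanSpace ℝ (Fin n) =>
          ((‖y‖₊, Quotient.mk _ (direction y)) : NNReal × SphereQuotient n)) x :=
        continuous_nnnorm.continuousAt.prodMk
          (continuous_quotient_mk'.continuousAt.comp (continuousAt_direction hx))
      exact hmk.continuousAt.comp h2

/-- The open unit disc `D^m` in `ℝ^m`. -/
abbrev Disc (m : ℕ) : TopologicalSpace.Opens (EuclideanSpace ℝ (Fin m)) :=
  ⟨Metric.ball 0 1, Metric.isOpen_ball⟩

/-- The centre of the disc. -/
def centre (m : ℕ) : Disc m := ⟨0, by simp [Disc]⟩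

/-- The functional structure of the cone over `S^(n-1)/H`, where `H` is the group of sign vectors
with product `1`: that of `ℝ^n/H`, so that functions on the cone are smooth iff they are smooth on
`ℝ^n` in polar coordinates. -/
def coneStructure (n : ℕ) [NeZero n] : FunctionalStructure (Cone (SphereQuotient n)) :=
  (FunctionalStructure.ofManifold 𝓘(ℝ, EuclideanSpace ℝ (Fin n))).pushforward (coneMap n)

/-- The functional structure of the product of the disc `D^m` and the cone over `S^(n-1)/H`: that
of `(D^m × ℝ^n)/H`, where `H` acts on the second factor. -/
def discConeStructure (m n : ℕ) [NeZero n] :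
    FunctionalStructure (Disc m × Cone (SphereQuotient n)) :=
  (FunctionalStructure.ofManifold
    (𝓘(ℝ, EuclideanSpace ℝ (Fin m)).prod 𝓘(ℝ, EuclideanSpace ℝ (Fin n)))).pushforward
      ((ContinuousMap.id (Disc m)).prodMap (coneMap n))

/-! ## The isotropy action -/

/-- The stabilizer of `p`, modulo the subgroup `{±1}` that acts trivially on the Grassmannian, is
isomorphic to the group of sign vectors in `ℤ₂^n` with product `1`; and its isotropy representation
on the tangent space at `p` (by the differentials at `p`) is the direct sum of an `m`-dimensional
trivial representation and of the representation on `ℝ^n` by changes of signs. -/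
def HasIsotropyType (m n : ℕ) (p : Gr42) : Prop :=
  ∃ (φ : MulAction.stabilizer Signs p →* evenSigns n)
    (Ψ : TangentSpace 𝓘(ℝ, Model) p ≃L[ℝ] EuclideanSpace ℝ (Fin m) × EuclideanSpace ℝ (Fin n)),
    Function.Surjective φ ∧ (∀ g, φ g = 1 ↔ (g : Signs) = 1 ∨ (g : Signs) = -1) ∧
    ∀ (g : MulAction.stabilizer Signs p) (v : TangentSpace 𝓘(ℝ, Model) p),
      Ψ (mfderiv 𝓘(ℝ, Model) 𝓘(ℝ, Model) (fun x : Gr42 => (g : Signs) • x) p v) =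
        ((Ψ v).1, signVec (φ g).1 (Ψ v).2)

/-- `p : M → N` is a smooth map that induces the smooth structure of `N`: a function on an open
subset of `N` is smooth as soon as its composition with `p` is smooth. -/
def InducesSmoothStructure {E H M E' H' N : Type}
    [NormedAddCommGroup E] [NormedSpace ℝ E] [TopologicalSpace H] (I : ModelWithCorners ℝ E H)
    [TopologicalSpace M] [ChartedSpace H M]
    [NormedAddCommGroup E'] [NormedSpace ℝ E'] [TopologicalSpace H'] (J : ModelWithCorners ℝ E' H')
    [TopologicalSpace N] [ChartedSpace H' N] (p : M → N) : Prop :=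
  ContMDiff I J ∞ p ∧ ∀ (V : Set N) (f : N → ℝ), IsOpen V →
    ContMDiffOn I 𝓘(ℝ, ℝ) ∞ (f ∘ p) (p ⁻¹' V) → ContMDiffOn J 𝓘(ℝ, ℝ) ∞ f V

end Gr42

end

/-! In a standard chart a plane is the graph of a 2 × 2 matrix `A`. A sign vector multiplies the
entry `A i j` by the product of a row sign and a column sign. These four characters have product 1,
every sign matrix with product 1 arises, and the kernel is ±1. A chart domain is invariant, so its
image in the orbit space is `ℝ⁴` modulo the even sign changes.

Let `m` be the number of nonzero entries of `A`. The stabilizer consists of the signs that are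
trivial on those entries. For `m ≥ 3` the product relation makes the remaining character trivial as
well, so the orbit has `2 ^ min m 3` points (`ncard_fibre`).

For `m ≤ 2` the stabilizer acts on the `n = 4 - m` vanishing coordinates through all even sign
changes. A small disc in the nonzero coordinates, times `ℝⁿ`, is a slice: two of its points share an
orbit exactly when they differ by such a change (`orbitSlice_eq_iff`). The slice and the polar map
to the disc times the cone are thus open maps from one source with the same fibres, and smoothness
on both sides is tested on that source (`isLocalIso_homeoOfSameFibres`). For `m ≥ 3` the same
argument, with all four coordinates in the disc, gives a manifold chart.

Singularity comes from two vanishing coordinates: changing both signs folds the line of one of them.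
Its image is a smooth even curve on which the smooth function "square of that coordinate" equals `t
^ 2`. In a manifold chart the curve would have zero velocity at `t = 0`, where the function has a
minimum, so the second derivative along the curve would be 0 instead of 2
(`isSingularPoint_of_even_curve`). A smooth structure induced by the projection would make every
point smooth, but the orbit of a coordinate plane is singular. -/

noncomputable section

/-! ### Spaces with a common source of test functions -/

namespace FunctionalStructure

/-- On the open subsets of the range of `a`, the functional structure `F` is the one induced by the
functional structure `K` along `a`. -/
def IsInducedAlong {P X : Type} [TopologicalSpace P] [TopologicalSpace X]
    (F : FunctionalStructure X) (K : FunctionalStructure P) (a : C(P, X)) : Prop :=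
  ∀ (V : TopologicalSpace.Opens X) (f : X → ℝ), (V : Set X) ⊆ Set.range a →
    (F.IsSmooth V f ↔ K.IsSmooth (V.comap a) (f ∘ a))

/-- An open map sends neighbourhoods of `x` to neighbourhoods of `a x`, so limits along `a` control
limits at `a x`. -/
theorem continuousOn_of_comp_isOpenMap {P X Z : Type*} [TopologicalSpace P] [TopologicalSpace X]
    [TopologicalSpace Z] {a : P → X} (ha : IsOpenMap a) {V : Set X} (hV : IsOpen V)
    (hVa : V ⊆ Set.range a) (hc : Continuous a) {f : X → Z} (h : ContinuousOn (f ∘ a) (a ⁻¹' V)) :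
    ContinuousOn f V := by
  intro y hy
  obtain ⟨x, rfl⟩ := hVa hy
  have h1 : ContinuousAt (f ∘ a) x := h.continuousAt ((hV.preimage hc).mem_nhds hy)
  have h2 : Filter.Tendsto f (Filter.map a (nhds x)) (nhds (f (a x))) := Filter.tendsto_map'_iff.2 h1
  exact ContinuousAt.continuousWithinAt (h2.mono_left (ha.nhds_le x))

/-- The continuity clause of a push-forward is automatic when the map is open. -/
theorem isInducedAlong_pushforward {P X : Type} [TopologicalSpace P] [TopologicalSpace X]
    (K : FunctionalStructure P) {a : C(P, X)} (ha : IsOpenMap a) :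
    (K.pushforward a).IsInducedAlong K a := by
  intro V f hV
  exact ⟨fun h => h.2, fun h =>
    ⟨continuousOn_of_comp_isOpenMap ha V.isOpen hV a.continuous (K.continuousOn h), h⟩⟩

/-- Two open continuous maps with the same fibres identify their ranges. -/
def homeoOfSameFibres {P X Y : Type*} [TopologicalSpace P] [TopologicalSpace X]
    [TopologicalSpace Y] [Nonempty P] (a : C(P, X)) (b : C(P, Y)) (ha : IsOpenMap a)
    (hb : IsOpenMap b) (hab : ∀ x x', a x = a x' ↔ b x = b x') : OpenPartialHomeomorph X Y :=
  have h1 : ∀ x, Function.extend a b (fun _ => b (Classical.arbitrary P)) (a x) = b x :=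
    Function.FactorsThrough.extend_apply (fun x x' h => (hab x x').1 h) _
  have h2 : ∀ x, Function.extend b a (fun _ => a (Classical.arbitrary P)) (b x) = a x :=
    Function.FactorsThrough.extend_apply (fun x x' h => (hab x x').2 h) _
  { toFun := Function.extend a b (fun _ => b (Classical.arbitrary P))
    invFun := Function.extend b a (fun _ => a (Classical.arbitrary P))
    source := Set.range a
    target := Set.range b
    map_source' := by rintro _ ⟨x, rfl⟩; exact ⟨x, (h1 x).symm⟩
    map_target' := by rintro _ ⟨x, rfl⟩; exact ⟨x, (h2 x).symm⟩
    left_inv' := by rintro _ ⟨x, rfl⟩; rw [h1, h2]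
    right_inv' := by rintro _ ⟨x, rfl⟩; rw [h2, h1]
    open_source := ha.isOpen_range
    open_target := hb.isOpen_range
    continuousOn_toFun := continuousOn_of_comp_isOpenMap ha ha.isOpen_range subset_rfl a.continuous
      (b.continuous.continuousOn.congr fun x _ => h1 x)
    continuousOn_invFun := continuousOn_of_comp_isOpenMap hb hb.isOpen_range subset_rfl b.continuous
      (a.continuous.continuousOn.congr fun x _ => h2 x) }

theorem homeoOfSameFibres_apply {P X Y : Type*} [TopologicalSpace P] [TopologicalSpace X]
    [TopologicalSpace Y] [Nonempty P] (a : C(P, X)) (b : C(P, Y)) (ha : IsOpenMap a)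
    (hb : IsOpenMap b) (hab : ∀ x x', a x = a x' ↔ b x = b x') (x : P) :
    homeoOfSameFibres a b ha hb hab (a x) = b x :=
  Function.FactorsThrough.extend_apply (f := a) (g := b) (fun x x' h => (hab x x').1 h)
    (fun _ => b (Classical.arbitrary P)) x

/-- Pulled back to `P`, a function on `Y` and its transport to `X` are the same function on the same
open set. -/
theorem isLocalIso_homeoOfSameFibres {P X Y : Type} [TopologicalSpace P] [TopologicalSpace X]
    [TopologicalSpace Y] [Nonempty P] {a : C(P, X)} {b : C(P, Y)} (ha : IsOpenMap a)
    (hb : IsOpenMap b) (hab : ∀ x x', a x = a x' ↔ b x = b x') {F : FunctionalStructure X}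
    {G : FunctionalStructure Y} {K : FunctionalStructure P} (hF : F.IsInducedAlong K a)
    (hG : G.IsInducedAlong K b) : F.IsLocalIso G (homeoOfSameFibres a b ha hb hab) := by
  intro V f hV
  have h1 := homeoOfSameFibres_apply a b ha hb hab
  rw [hG V f hV, hF _ _ (show _ ∩ _ ⊆ Set.range a from Set.inter_subset_left)]
  have hf : (f ∘ homeoOfSameFibres a b ha hb hab) ∘ a = f ∘ b := by
    ext x
    simp [h1]
  rw [hf]
  have hU : ∀ U U' : TopologicalSpace.Opens P, U = U' →
      (K.IsSmooth U (f ∘ b) ↔ K.IsSmooth U' (f ∘ b)) := by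
    rintro U _ rfl
    rfl
  refine hU _ _ ?_
  ext x
  change b x ∈ V ↔ a x ∈ Set.range a ∧ homeoOfSameFibres a b ha hb hab (a x) ∈ V
  simp [h1]

/-! ### A criterion for singular points -/

/-- A point through which there passes an even smooth curve `c`, such that some nonnegative smooth
function takes the value `t ^ 2` at `c t`, is singular. -/
theorem isSingularPoint_of_even_curve {X : Type} [TopologicalSpace X] {F : FunctionalStructure X}
    {q : X} {c : ℝ → X} (hc0 : c 0 = q) (hcc : ContinuousAt c 0) (hce : ∀ t, c (-t) = c t)
    (hcs : ∀ V f, F.IsSmooth V f → q ∈ V → ContDiffAt ℝ ∞ (f ∘ c) 0)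
    {V : TopologicalSpace.Opens X} {f : X → ℝ} (hqV : q ∈ V) (hf : F.IsSmooth V f)
    (hf0 : ∀ x, 0 ≤ f x) (hft : ∀ t, f (c t) = t ^ 2) : F.IsSingularPoint q := by
  rintro d ⟨e, hqe, he⟩
  set g : ℝ → EuclideanSpace ℝ (Fin d) := fun t => e (c t) with hg
  have hg_smooth : ContDiffAt ℝ ∞ g 0 := by
    -- The coordinates of a manifold chart belong to the functional structure, so their compositions
    -- with `c` are smooth.
    rw [contDiffAt_euclidean]
    intro i
    have h1 := (he ⟨e.target, e.open_target⟩ (fun y => y i) subset_rfl).1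
      (ContDiff.contMDiff (by fun_prop)).contMDiffOn
    exact hcs _ _ h1 ⟨hqe, e.map_source hqe⟩
  replace hg_smooth : ContDiffAt ℝ 2 g 0 := hg_smooth.of_le (by norm_cast)
  have hg0 : g 0 = e q := by rw [hg]; simp [hc0]
  set V' : TopologicalSpace.Opens (EuclideanSpace ℝ (Fin d)) :=
    ⟨e.target ∩ e.symm ⁻¹' V, e.isOpen_inter_preimage_symm V.isOpen⟩
  have hqV' : e q ∈ V' := ⟨e.map_source hqe, by simpa [e.left_inv hqe] using hqV⟩
  have hfs : ContMDiffOn 𝓘(ℝ, EuclideanSpace ℝ (Fin d)) 𝓘(ℝ, ℝ) ∞ (f ∘ e.symm) V' := by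
    refine (he V' (f ∘ e.symm) fun y hy => hy.1).2 ?_
    refine F.congr (f := f) (F.restrict (U := V) ?_ hf) ?_
    · intro x hx
      have h2 : e.symm (e x) ∈ V := hx.2.2
      rwa [e.left_inv hx.1] at h2
    · intro x hx
      simp [e.left_inv hx.1]
  have hfs' : ContDiffAt ℝ 2 (f ∘ e.symm) (g 0) := by
    rw [hg0]
    exact (hfs.contMDiffAt (V'.isOpen.mem_nhds hqV')).contDiffAt.of_le (by norm_cast)
  -- The nonnegative function `f` vanishes at `q = c 0`.
  have hmin : fderiv ℝ (f ∘ e.symm) (g 0) = 0 := by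
    refine IsLocalMin.fderiv_eq_zero (Filter.Eventually.of_forall fun y => ?_)
    have h3 : f (e.symm (g 0)) = 0 := by
      rw [hg0, e.left_inv hqe, ← hc0, hft]
      simp
    simpa [h3] using hf0 _
  -- The derivative of an even curve is odd.
  have hg' : deriv g 0 = 0 := by
    have h4 : deriv g 0 = -deriv g 0 := by
      have h5 := deriv_comp_neg g 0
      have h6 : (fun t => g (-t)) = g := by
        ext1 t
        simp [hg, hce]
      rw [h6, neg_zero] at h5
      exact h5
    have h4' : (2 : ℝ) • deriv g 0 = 0 := by
      rw [two_smul]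
      nth_rewrite 1 [h4]
      simp
    simpa using h4'
  have hcomp : (fun t => (f ∘ e.symm) (g t)) =ᶠ[nhds 0] fun t => t ^ 2 := by
    have h7 : ∀ᶠ t in nhds 0, c t ∈ e.source :=
      hcc.eventually_mem (by rw [hc0]; exact e.open_source.mem_nhds hqe)
    filter_upwards [h7] with t ht
    simp [hg, e.left_inv ht, hft]
  have hd1 : ∀ᶠ t in nhds 0, fderiv ℝ (f ∘ e.symm) (g t) (deriv g t) = 2 * t := by
    have h8 : ∀ᶠ t in nhds 0, DifferentiableAt ℝ g t :=
      (hg_smooth.eventually (by simp)).mono fun t ht => ht.differentiableAt (by simp)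
    have h9 : ∀ᶠ t in nhds 0, DifferentiableAt ℝ (f ∘ e.symm) (g t) :=
      (hg_smooth.continuousAt.eventually (hfs'.eventually (by simp))).mono
        fun t ht => ht.differentiableAt (by simp)
    filter_upwards [h8, h9, hcomp.eventuallyEq_nhds] with t ht1 ht2 ht3
    have h10 : HasDerivAt (fun t => (f ∘ e.symm) (g t)) (fderiv ℝ (f ∘ e.symm) (g t) (deriv g t)) t :=
      ht2.hasFDerivAt.comp_hasDerivAt t ht1.hasDerivAt
    have h11 : HasDerivAt (fun t : ℝ => t ^ 2) (2 * t) t := by simpa using hasDerivAt_pow 2 t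
    exact (h10.congr_of_eventuallyEq ht3.symm).unique h11
  have hD : DifferentiableAt ℝ (fun t => fderiv ℝ (f ∘ e.symm) (g t)) 0 := by
    have h12 : DifferentiableAt ℝ (fderiv ℝ (f ∘ e.symm)) (g 0) :=
      (hfs'.fderiv_right (m := 1) (by norm_num)).differentiableAt (by simp)
    exact h12.comp 0 (hg_smooth.differentiableAt (by simp))
  have hg2 : DifferentiableAt ℝ (deriv g) 0 := by
    have h13 : ContDiffAt ℝ 1 (deriv g) 0 := by
      have h14 : ContDiffAt ℝ 1 (fderiv ℝ g) 0 :=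
        hg_smooth.fderiv_right (m := 1) (by norm_num)
      exact h14.clm_apply contDiffAt_const
    exact h13.differentiableAt (by simp)
  -- Differentiating `D(g t)(g' t) = 2 t` at 0 by the product rule: one term contains `g' 0 = 0`,
  -- the other `D(g 0) = 0`, which leaves `2 = 0`.
  have h15 := hD.hasDerivAt.clm_apply hg2.hasDerivAt
  rw [hmin, hg'] at h15
  have h16 : HasDerivAt (fun t : ℝ => 2 * t) 2 0 := by simpa using (hasDerivAt_id (0 : ℝ)).const_mul 2
  have h17 := (h16.congr_of_eventuallyEq hd1).unique h15
  simp at h17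

end FunctionalStructure

/-! ### Consequence of an induced smooth structure -/

namespace Gr42

/-- If `h ∘ proj` induces a smooth structure, then the orbit space has smooth points only. -/
theorem isSmoothPoint_of_inducesSmoothStructure {d : ℕ} {N : Type} [TopologicalSpace N]
    [ChartedSpace (EuclideanSpace ℝ (Fin d)) N] [IsManifold 𝓘(ℝ, EuclideanSpace ℝ (Fin d)) ∞ N]
    (h : OrbitSpace ≃ₜ N)
    (hh : InducesSmoothStructure 𝓘(ℝ, Model) 𝓘(ℝ, EuclideanSpace ℝ (Fin d)) (h ∘ proj))
    (q : OrbitSpace) : orbitStructure.IsSmoothPoint d q := by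
  set ψ := chartAt (EuclideanSpace ℝ (Fin d)) (h q)
  refine ⟨h.toOpenPartialHomeomorph.trans ψ, ?_, ?_⟩
  · simp [ψ]
  intro V f hV
  have hV' : (V : Set _) ⊆ ψ.target := fun y hy => (hV hy).1
  have hW : IsOpen (ψ.source ∩ ψ ⁻¹' V) := ψ.isOpen_inter_preimage V.isOpen
  constructor
  -- This direction uses that `h ∘ proj` is smooth, the converse that it induces the structure of
  -- `N`.
  · intro hf
    have hf' : ContMDiffOn _ 𝓘(ℝ, ℝ) ∞ f V := hf
    have h1 : ContMDiffOn 𝓘(ℝ, EuclideanSpace ℝ (Fin d)) 𝓘(ℝ, ℝ) ∞ (f ∘ ψ)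
        (ψ.source ∩ ψ ⁻¹' V) :=
      hf'.comp (contMDiffOn_chart.mono Set.inter_subset_left) fun x hx => hx.2
    refine ⟨?_, ?_⟩
    · refine h1.continuousOn.comp h.continuous.continuousOn fun x hx => ⟨?_, hx.2⟩
      simpa using hx.1
    · refine h1.comp hh.1.contMDiffOn fun x hx => ⟨?_, hx.2⟩
      simpa using hx.1
  · rintro ⟨-, hf⟩
    have h1 : ContMDiffOn 𝓘(ℝ, EuclideanSpace ℝ (Fin d)) 𝓘(ℝ, ℝ) ∞ (f ∘ ψ)
        (ψ.source ∩ ψ ⁻¹' V) := by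
      refine hh.2 _ _ hW (ContMDiffOn.mono hf fun x hx => ⟨?_, hx.2⟩)
      simpa using hx.1
    have h2 : ContMDiffOn 𝓘(ℝ, EuclideanSpace ℝ (Fin d)) 𝓘(ℝ, ℝ) ∞ ((f ∘ ψ) ∘ ψ.symm) V := by
      refine h1.comp ((contMDiffOn_chart_symm (x := h q)).mono hV') fun y hy =>
        ⟨ψ.map_target (hV' hy), ?_⟩
      change ψ (ψ.symm y) ∈ V
      rwa [ψ.right_inv (hV' hy)]
    exact h2.congr fun y hy => by simp [ψ.right_inv (hV' hy)]

/-! ### The sign action in the charts -/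

/-- The characters by which the sign vectors act on the coordinates of the chart `e`. -/
def chartSigns (e : Fin 2 ⊕ Fin 2 ≃ Fin 4) : Signs →* (Fin 2 × Fin 2 → ℤˣ) where
  toFun g z := g (e (Sum.inr z.1)) * g (e (Sum.inl z.2))
  map_one' := by ext; simp
  map_mul' g h := by
    ext z
    simp only [Pi.mul_apply]
    rw [mul_mul_mul_comm]

/-- Each row sign and each column sign enters exactly two of the four factors. -/
theorem prod_chartSigns (e : Fin 2 ⊕ Fin 2 ≃ Fin 4) (g : Signs) : ∏ z, chartSigns e g z = 1 := by
  have key : ∀ h : Fin 2 ⊕ Fin 2 → ℤˣ,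
      ∏ z : Fin 2 × Fin 2, h (Sum.inr z.1) * h (Sum.inl z.2) = 1 := by decide
  exact key (g ∘ e)

theorem exists_chartSigns (e : Fin 2 ⊕ Fin 2 ≃ Fin 4) {s : Fin 2 × Fin 2 → ℤˣ}
    (hs : ∏ z, s z = 1) : ∃ g, chartSigns e g = s := by
  have h1 : s (1, 1) = s (0, 0) * s (0, 1) * s (1, 0) := by
    simp only [Fintype.prod_prod_type, Fin.prod_univ_two] at hs
    rcases Int.units_eq_one_or (s (0, 0)) with h | h <;>
    rcases Int.units_eq_one_or (s (0, 1)) with h' | h' <;>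
    rcases Int.units_eq_one_or (s (1, 0)) with h'' | h'' <;>
    rcases Int.units_eq_one_or (s (1, 1)) with h3 | h3 <;>
    simp [h, h', h'', h3] at hs ⊢
  -- As ±1 acts trivially, the first column sign may be taken to be 1. The first column of `s` then
  -- gives the row signs, and the entry (0, 1) the second column sign; the entry (1, 1) agrees by
  -- the product relation.
  refine ⟨Sum.elim ![1, s (0, 0) * s (0, 1)] ![s (0, 0), s (1, 0)] ∘ e.symm, ?_⟩
  funext z
  obtain ⟨i, j⟩ := z
  fin_cases i <;> fin_cases j <;> simp [chartSigns, h1]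
  · rw [← mul_assoc, Int.units_mul_self, one_mul]
  · rw [mul_comm]

/-- If all four products are 1, every row sign equals every column sign, so all signs agree. -/
theorem chartSigns_eq_one_iff (e : Fin 2 ⊕ Fin 2 ≃ Fin 4) (g : Signs) :
    chartSigns e g = 1 ↔ g = 1 ∨ g = -1 := by
  have key : ∀ h : Fin 2 ⊕ Fin 2 → ℤˣ,
      (∀ z : Fin 2 × Fin 2, h (Sum.inr z.1) * h (Sum.inl z.2) = 1) ↔
        (∀ k, h k = 1) ∨ (∀ k, h k = -1) := by decide
  have h1 := key (g ∘ e)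
  have h2 : ∀ c : ℤˣ, (∀ k, (g ∘ e) k = c) ↔ g = fun _ => c := by
    intro c
    rw [funext_iff, e.surjective.forall]
    rfl
  rw [h2, h2] at h1
  rw [funext_iff]
  exact h1

/-- A sign vector acting on the coordinates of the chart `e`. -/
def modelAct (e : Fin 2 ⊕ Fin 2 ≃ Fin 4) (g : Signs) (A : Model) : Model :=
  fun i j => ((chartSigns e g (i, j) : ℤ) : ℝ) * A i j

theorem graphMatrix_inl (e : Fin 2 ⊕ Fin 2 ≃ Fin 4) (A : Model) (k j : Fin 2) :
    graphMatrix e A (e (Sum.inl k)) j = if k = j then 1 else 0 := by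
  rw [← Matrix.one_apply]
  exact congrFun (congrFun (top_graphMatrix e A) k) j

theorem graphMatrix_inr (e : Fin 2 ⊕ Fin 2 ≃ Fin 4) (A : Model) (k j : Fin 2) :
    graphMatrix e A (e (Sum.inr k)) j = A k j :=
  congrFun (congrFun (bot_graphMatrix e A) k) j

/-- Applying `g` to the rows of the graph matrix spoils its identity block. Composing on the right
with the diagonal matrix `D` of the same signs restores the block without changing the range, and
turns `A i j` into its product with a row and a column sign. -/
theorem smul_chart_symm (e : Fin 2 ⊕ Fin 2 ≃ Fin 4) (g : Signs) (A : Model) :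
    g • (chart e).symm A = (chart e).symm (modelAct e g A) := by
  let D : (Fin 2 → ℝ) →ₗ[ℝ] (Fin 2 → ℝ) :=
    LinearMap.pi fun j => ((g (e (Sum.inl j)) : ℤ) : ℝ) • LinearMap.proj j
  have hsq : ∀ k, ((g k : ℤ) : ℝ) * ((g k : ℤ) : ℝ) = 1 := by
    intro k
    rcases Int.units_eq_one_or (g k) with h | h <;> simp [h]
  have hD : LinearMap.range D = ⊤ := by
    rw [LinearMap.range_eq_top]
    intro w
    refine ⟨D w, ?_⟩
    ext j
    simp [D, ← mul_assoc, hsq]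
  apply Subtype.ext
  change (LinearMap.range (graphMatrix e A).mulVecLin).map (signMap g).toLinearMap =
    LinearMap.range (graphMatrix e (modelAct e g A)).mulVecLin
  rw [← LinearMap.range_comp, ← LinearMap.range_comp_of_range_eq_top _ hD]
  congr 1
  apply LinearMap.ext
  intro w
  ext k
  obtain ⟨k, rfl⟩ := e.surjective k
  change ((g (e k) : ℤ) : ℝ) *
      ∑ j, graphMatrix e A (e k) j * (((g (e (Sum.inl j)) : ℤ) : ℝ) * w j) =
    ∑ j, graphMatrix e (modelAct e g A) (e k) j * w j
  rcases k with k | k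
  · simp [graphMatrix_inl, ← mul_assoc, hsq]
  · simp only [graphMatrix_inr, modelAct, chartSigns, Fin.sum_univ_two, MonoidHom.coe_mk,
      OneHom.coe_mk]
    push_cast
    ring

theorem mem_target_chart (e : Fin 2 ⊕ Fin 2 ≃ Fin 4) (A : Model) : A ∈ (chart e).target :=
  Set.mem_univ A

theorem chart_chart_symm (e : Fin 2 ⊕ Fin 2 ≃ Fin 4) (A : Model) :
    chart e ((chart e).symm A) = A := (chart e).right_inv (mem_target_chart e A)

theorem chart_symm_mem_source (e : Fin 2 ⊕ Fin 2 ≃ Fin 4) (A : Model) :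
    (chart e).symm A ∈ (chart e).source := (chart e).map_target (mem_target_chart e A)

theorem chart_symm_injective (e : Fin 2 ⊕ Fin 2 ≃ Fin 4) : Function.Injective (chart e).symm :=
  fun A B h => by rw [← chart_chart_symm e A, h, chart_chart_symm]

theorem chart_mem_maximalAtlas (e : Fin 2 ⊕ Fin 2 ≃ Fin 4) :
    chart e ∈ IsManifold.maximalAtlas 𝓘(ℝ, Model) ∞ Gr42 :=
  IsManifold.subset_maximalAtlas ⟨e, rfl⟩

theorem contMDiff_chart_symm (e : Fin 2 ⊕ Fin 2 ≃ Fin 4) :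
    ContMDiff 𝓘(ℝ, Model) 𝓘(ℝ, Model) ∞ (chart e).symm := by
  rw [← contMDiffOn_univ]
  exact contMDiffOn_symm_of_mem_maximalAtlas (chart_mem_maximalAtlas e)

theorem contMDiffAt_chart (e : Fin 2 ⊕ Fin 2 ≃ Fin 4) {p : Gr42} (hp : p ∈ (chart e).source) :
    ContMDiffAt 𝓘(ℝ, Model) 𝓘(ℝ, Model) ∞ (chart e) p :=
  (contMDiffOn_of_mem_maximalAtlas (chart_mem_maximalAtlas e)).contMDiffAt
    ((chart e).open_source.mem_nhds hp)

theorem smul_eq_of_mem_source (e : Fin 2 ⊕ Fin 2 ≃ Fin 4) (g : Signs) {p : Gr42}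
    (hp : p ∈ (chart e).source) : g • p = (chart e).symm (modelAct e g (chart e p)) := by
  rw [← smul_chart_symm, (chart e).left_inv hp]

theorem contDiff_modelAct (e : Fin 2 ⊕ Fin 2 ≃ Fin 4) (g : Signs) :
    ContDiff ℝ ∞ (modelAct e g) := by
  unfold modelAct
  fun_prop

/-- Every chart domain is invariant, and in the chart the action is linear. -/
theorem contMDiff_smul (g : Signs) :
    ContMDiff 𝓘(ℝ, Model) 𝓘(ℝ, Model) ∞ fun p : Gr42 => g • p := by
  intro p
  obtain ⟨e, he⟩ := exists_chart p
  have h : ContMDiffAt 𝓘(ℝ, Model) 𝓘(ℝ, Model) ∞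
      (fun p => (chart e).symm (modelAct e g (chart e p))) p :=
    ((contMDiff_chart_symm e).comp (contDiff_modelAct e g).contMDiff).contMDiffAt.comp p
      (contMDiffAt_chart e he)
  refine h.congr_of_eventuallyEq ?_
  filter_upwards [(chart e).open_source.mem_nhds he] with x hx
  exact smul_eq_of_mem_source e g hx

instance : ContinuousConstSMul Signs Gr42 := ⟨fun g => (contMDiff_smul g).continuous⟩

/-! ### The projection and the size of its fibres -/

theorem isOpenMap_proj : IsOpenMap proj := isOpenMap_quotient_mk'_mul

theorem proj_smul (g : Signs) (p : Gr42) : proj (g • p) = proj p :=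
  Quotient.sound ⟨g, rfl⟩

theorem proj_eq_iff {p p' : Gr42} : proj p = proj p' ↔ ∃ g : Signs, g • p = p' := by
  rw [eq_comm]
  exact Quotient.eq

theorem proj_surjective : Function.Surjective proj := Quotient.mk_surjective

theorem isOpenMap_chart_symm (e : Fin 2 ⊕ Fin 2 ≃ Fin 4) : IsOpenMap (chart e).symm := by
  intro U hU
  exact (chart e).symm.isOpen_image_of_subset_source hU fun A _ => mem_target_chart e A

theorem proj_chart_symm_eq_iff (e : Fin 2 ⊕ Fin 2 ≃ Fin 4) {A B : Model} :
    proj ((chart e).symm A) = proj ((chart e).symm B) ↔ ∃ g, modelAct e g A = B := by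
  rw [proj_eq_iff]
  simp only [smul_chart_symm, (chart_symm_injective e).eq_iff]

/-- The stabilizer of a plane in terms of its nonzero coordinates. -/
theorem smul_eq_self_iff (e : Fin 2 ⊕ Fin 2 ≃ Fin 4) (g : Signs) {p : Gr42}
    (hp : p ∈ (chart e).source) :
    g • p = p ↔ ∀ z : Fin 2 × Fin 2, chart e p z.1 z.2 ≠ 0 → chartSigns e g z = 1 := by
  have h1 : g • p = p ↔ modelAct e g (chart e p) = chart e p := by
    rw [smul_eq_of_mem_source e g hp]
    conv_lhs => rw [← (chart e).left_inv hp, chart_chart_symm]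
    rw [(chart_symm_injective e).eq_iff]
  rw [h1]
  constructor
  · intro h z hz
    have h2 := congrFun (congrFun h z.1) z.2
    rcases Int.units_eq_one_or (chartSigns e g z) with h3 | h3
    · exact h3
    · simp only [modelAct, h3] at h2
      norm_num at h2
      exact absurd (by linarith) hz
  · intro h
    funext i j
    by_cases hz : chart e p i j = 0
    · simp [modelAct, hz]
    · simp [modelAct, h (i, j) hz]

/-- Up to three of the conditions are independent and each halves the group of order 16; the fourth
follows from the others. Indexing by `Fin 2 ⊕ Fin 2` makes this a finite check that does not depend
on the chart. -/
theorem card_signs_eq_one_on : ∀ T : Finset (Fin 2 × Fin 2),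
    Fintype.card {h : Fin 2 ⊕ Fin 2 → ℤˣ // ∀ z ∈ T, h (Sum.inr z.1) * h (Sum.inl z.2) = 1} =
      if T.card = 0 then 16 else if T.card = 1 then 8 else if T.card = 2 then 4 else 2 := by
  decide +kernel

open Classical in
/-- The number of coordinates of `p` in the chart `e` that do not vanish. -/
def supportCard (e : Fin 2 ⊕ Fin 2 ≃ Fin 4) (p : Gr42) : ℕ :=
  (Finset.univ.filter fun z : Fin 2 × Fin 2 => chart e p z.1 z.2 ≠ 0).card

/-- The fibre is an orbit of a group of order 16, so the order of the stabilizer determines its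
size. -/
theorem ncard_fibre (e : Fin 2 ⊕ Fin 2 ≃ Fin 4) {p : Gr42} (hp : p ∈ (chart e).source) :
    (proj ⁻¹' {proj p}).ncard = 2 ^ min (supportCard e p) 3 := by
  classical
  have h1 : proj ⁻¹' {proj p} = MulAction.orbit Signs p := by
    ext x
    exact Quotient.eq
  have : Fintype (MulAction.orbit Signs p) := Set.fintypeRange _
  have h2 := MulAction.card_orbit_mul_card_stabilizer_eq_card_group Signs p
  have h3 : Fintype.card (MulAction.stabilizer Signs p) = _ :=
    (Fintype.card_congr (Equiv.subtypeEquiv (Equiv.arrowCongr e.symm (Equiv.refl ℤˣ)) fun g => by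
      rw [MulAction.mem_stabilizer_iff, smul_eq_self_iff e g hp]
      simp only [chartSigns, Finset.mem_filter, Finset.mem_univ, true_and]
      rfl)).trans (card_signs_eq_one_on
      (Finset.univ.filter fun z : Fin 2 × Fin 2 => chart e p z.1 z.2 ≠ 0))
  have h4 : Fintype.card Signs = 16 := by simp
  have h5 : supportCard e p ≤ 4 := by
    unfold supportCard
    exact (Finset.card_le_univ _).trans (by simp)
  have h6 : (Finset.univ.filter fun z : Fin 2 × Fin 2 => chart e p z.1 z.2 ≠ 0).card =
    supportCard e p := by
    unfold supportCard
    congr!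
  rw [h1, ← Nat.card_coe_set_eq, Nat.card_eq_fintype_card]
  rw [h3, h4, h6] at h2
  generalize supportCard e p = k at h2 h5
  interval_cases k <;> simp at h2 ⊢ <;> omega

/-! ## The cone as a quotient of the vector space -/

theorem signVec_smul {n : ℕ} (δ : Fin n → ℤˣ) (c : ℝ) (x : EuclideanSpace ℝ (Fin n)) :
    signVec δ (c • x) = c • signVec δ x := by
  ext i
  simp [signVec]
  ring

theorem signVec_add {n : ℕ} (δ : Fin n → ℤˣ) (x y : EuclideanSpace ℝ (Fin n)) :
    signVec δ (x + y) = signVec δ x + signVec δ y := by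
  ext i
  simp [signVec]
  ring

theorem signVec_one {n : ℕ} (x : EuclideanSpace ℝ (Fin n)) : signVec 1 x = x := by
  ext i
  simp [signVec]

theorem continuous_signVec {n : ℕ} (δ : Fin n → ℤˣ) : Continuous (signVec δ) := by
  unfold signVec
  fun_prop

instance (n : ℕ) : ContinuousConstSMul (evenSigns n) (UnitSphere n) :=
  ⟨fun δ => ((continuous_signVec δ.1).comp continuous_subtype_val).subtype_mk _⟩

/-- The arbitrary direction chosen at 0 is harmless, being multiplied by 0. -/
theorem norm_smul_direction {n : ℕ} [NeZero n] (x : EuclideanSpace ℝ (Fin n)) :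
    ‖x‖ • (direction x).1 = x := by
  by_cases hx : x = 0
  · simp [hx]
  · simp [direction, hx, smul_smul]

theorem direction_smul {n : ℕ} [NeZero n] {t : ℝ} (ht : 0 < t) (y : UnitSphere n) :
    direction (t • y.1) = y := by
  have hy : ‖y.1‖ = 1 := by simp
  have h0 : t • y.1 ≠ 0 := by
    rw [← norm_ne_zero_iff, norm_smul, hy]
    simp [ht.ne']
  apply Subtype.ext
  simp only [direction, h0, dite_false]
  rw [norm_smul, hy, smul_smul, Real.norm_of_nonneg ht.le, mul_one, inv_mul_cancel₀ ht.ne', one_smul]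

theorem coneMap_smul {n : ℕ} [NeZero n] (t : NNReal) (y : UnitSphere n) :
    coneMap n ((t : ℝ) • y.1) = Cone.mk t (Quotient.mk _ y) := by
  have hy : ‖y.1‖₊ = 1 := by
    apply NNReal.eq
    simp
  have hn : ‖(t : ℝ) • y.1‖₊ = t := by
    rw [nnnorm_smul, hy, mul_one]
    simp
  change Cone.mk _ _ = _
  rw [hn]
  rcases eq_or_ne t 0 with rfl | ht
  · exact Cone.mk_zero _ _
  · rw [direction_smul (by exact_mod_cast pos_iff_ne_zero.2 ht)]

theorem coneMap_surjective (n : ℕ) [NeZero n] : Function.Surjective (coneMap n) := by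
  intro w
  obtain ⟨⟨t, y⟩, rfl⟩ := Quotient.exists_rep w
  obtain ⟨y, rfl⟩ := Quotient.exists_rep y
  exact ⟨_, coneMap_smul t y⟩

theorem coneMap_zero (n : ℕ) [NeZero n] : coneMap n 0 = apex n := by
  change Cone.mk ‖(0 : EuclideanSpace ℝ (Fin n))‖₊ _ = Cone.mk 0 _
  rw [nnnorm_zero]
  exact Cone.mk_zero _ _

/-- Equal points of the cone have equal radii, and away from the apex their directions differ by a
group element; since the action is linear, rescaling carries it over to the vectors. -/
theorem coneMap_eq_iff {n : ℕ} [NeZero n] {x x' : EuclideanSpace ℝ (Fin n)} :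
    coneMap n x = coneMap n x' ↔ ∃ δ : evenSigns n, signVec δ.1 x' = x := by
  constructor
  · intro h
    obtain ⟨h1, h2⟩ := Quotient.exact h
    have h1' : ‖x‖ = ‖x'‖ := congrArg NNReal.toReal h1
    rcases h2 with h2 | h2
    · have hx : x = 0 := nnnorm_eq_zero.1 h2
      have hx' : x' = 0 := by rwa [hx, norm_zero, eq_comm, norm_eq_zero] at h1'
      exact ⟨1, by rw [hx, hx']; exact signVec_one 0⟩
    · obtain ⟨δ, hδ⟩ := Quotient.exact h2
      have hδ' : signVec δ.1 (direction x').1 = (direction x).1 := congrArg Subtype.val hδ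
      refine ⟨δ, ?_⟩
      rw [← norm_smul_direction x', signVec_smul, hδ', ← h1', norm_smul_direction]
  · rintro ⟨δ, rfl⟩
    have h1 : coneMap n (signVec δ.1 x') = coneMap n (‖x'‖ • (δ • direction x').1) := by
      change _ = coneMap n (‖x'‖ • signVec δ.1 (direction x').1)
      rw [← signVec_smul, norm_smul_direction]
    rw [h1]
    conv_rhs => rw [← norm_smul_direction x']
    rw [← coe_nnnorm, coneMap_smul, coneMap_smul]
    congr 1
    exact Quotient.sound ⟨δ, rfl⟩

/-- A product of quotient maps need not be a quotient map; here the orbit map of the sphere is also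
open, and products of open quotient maps are again such. -/
theorem isQuotientMap_coneMk (n : ℕ) : Topology.IsQuotientMap
    fun a : NNReal × UnitSphere n => (Cone.mk a.1 (Quotient.mk _ a.2) : Cone (SphereQuotient n)) := by
  have hq : IsOpenQuotientMap (fun y : UnitSphere n => (Quotient.mk _ y : SphereQuotient n)) :=
    ⟨Quotient.mk_surjective, continuous_quotient_mk', isOpenMap_quotient_mk'_mul⟩
  have h1 := ((IsOpenQuotientMap.id (X := NNReal)).prodMap hq).isQuotientMap
  have h2 : Topology.IsQuotientMap
      fun a : NNReal × SphereQuotient n => (Cone.mk a.1 a.2 : Cone (SphereQuotient n)) :=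
    isQuotientMap_quotient_mk'
  exact h2.comp h1

/-- The saturation of `U` is the union of its translates under the group. Openness is tested on `[0,
∞) × S^(n-1)`, where it becomes the preimage of this union under scalar multiplication. -/
theorem isOpenMap_coneMap (n : ℕ) [NeZero n] : IsOpenMap (coneMap n) := by
  intro U hU
  rw [← (isQuotientMap_coneMk n).isOpen_preimage]
  have h3 : (fun a : NNReal × UnitSphere n =>
      (Cone.mk a.1 (Quotient.mk _ a.2) : Cone (SphereQuotient n))) ⁻¹' (coneMap n '' U) =
        (fun a : NNReal × UnitSphere n => (a.1 : ℝ) • a.2.1) ⁻¹'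
          ⋃ δ : evenSigns n, signVec δ.1 ⁻¹' U := by
    ext a
    rw [Set.mem_preimage, ← coneMap_smul]
    simp only [Set.mem_image, coneMap_eq_iff, Set.mem_preimage, Set.mem_iUnion]
    constructor
    · rintro ⟨x, hx, δ, rfl⟩
      exact ⟨δ, hx⟩
    · rintro ⟨δ, hδ⟩
      exact ⟨_, hδ, δ, rfl⟩
  have h4 : ∀ δ : Fin n → ℤˣ, IsOpen (signVec δ ⁻¹' U) := fun δ =>
    hU.preimage (continuous_signVec δ)
  have h5 : IsOpen (⋃ δ : evenSigns n, signVec δ.1 ⁻¹' U) := isOpen_iUnion fun δ => h4 δ.1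
  have h6 : Continuous fun a : NNReal × UnitSphere n => (a.1 : ℝ) • a.2.1 :=
    (NNReal.continuous_coe.comp continuous_fst).smul (continuous_subtype_val.comp continuous_snd)
  rw [h3]
  exact h6.isOpen_preimage _ h5

/-- A unit vector has a nonzero coordinate, and an even sign change that flips it moves the vector.
-/
theorem exists_smul_ne {n : ℕ} (hn : ∀ i : Fin n, ∃ δ : Fin n → ℤˣ, ∏ k, δ k = 1 ∧ δ i = -1)
    (x : UnitSphere n) : ∃ δ : evenSigns n, δ • x ≠ x := by
  have hx : x.1 ≠ 0 := fun h => by simpa [h] using x.2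
  have h1 : ∃ i, x.1 i ≠ 0 := by
    by_contra! h
    exact hx (by ext i; exact h i)
  obtain ⟨i, hi⟩ := h1
  obtain ⟨δ, hδ, hδi⟩ := hn i
  refine ⟨⟨δ, hδ⟩, fun h => ?_⟩
  have h2 : ((δ i : ℤ) : ℝ) * x.1 i = x.1 i := congrArg (fun y : UnitSphere n => y.1 i) h
  rw [hδi] at h2
  norm_num at h2
  exact hi (by linarith)

/-! ## Splitting the coordinates of a chart -/

/-- The coordinates of a chart, distributed over two Euclidean spaces. -/
def split {m n : ℕ} (s : Fin 2 × Fin 2 ≃ Fin m ⊕ Fin n) :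
    Model ≃L[ℝ] EuclideanSpace ℝ (Fin m) × EuclideanSpace ℝ (Fin n) :=
  LinearEquiv.toContinuousLinearEquiv
    { toFun A := (WithLp.toLp 2 fun k => A (s.symm (Sum.inl k)).1 (s.symm (Sum.inl k)).2,
        WithLp.toLp 2 fun k => A (s.symm (Sum.inr k)).1 (s.symm (Sum.inr k)).2)
      invFun y i j := Sum.elim (fun k => y.1 k) (fun k => y.2 k) (s (i, j))
      map_add' _ _ := rfl
      map_smul' _ _ := rfl
      left_inv A := by
        funext i j
        obtain ⟨z, hz⟩ : ∃ z, s (i, j) = z := ⟨_, rfl⟩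
        have hz' : s.symm z = (i, j) := by rw [← hz, Equiv.symm_apply_apply]
        change Sum.elim _ _ (s (i, j)) = _
        rw [hz]
        rcases z with k | k <;> simp [hz']
      right_inv y := by
        apply Prod.ext <;> ext k <;> simp }

/-- The signs by which `g` acts on the first part of the coordinates. -/
def leftSigns {m n : ℕ} (e : Fin 2 ⊕ Fin 2 ≃ Fin 4) (s : Fin 2 × Fin 2 ≃ Fin m ⊕ Fin n)
    (g : Signs) : Fin m → ℤˣ := fun k => chartSigns e g (s.symm (Sum.inl k))

/-- The signs by which `g` acts on the second part of the coordinates. -/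
def rightSigns {m n : ℕ} (e : Fin 2 ⊕ Fin 2 ≃ Fin 4) (s : Fin 2 × Fin 2 ≃ Fin m ⊕ Fin n)
    (g : Signs) : Fin n → ℤˣ := fun k => chartSigns e g (s.symm (Sum.inr k))

theorem split_modelAct {m n : ℕ} (e : Fin 2 ⊕ Fin 2 ≃ Fin 4) (s : Fin 2 × Fin 2 ≃ Fin m ⊕ Fin n)
    (g : Signs) (A : Model) : split s (modelAct e g A) =
      (signVec (leftSigns e s g) (split s A).1, signVec (rightSigns e s g) (split s A).2) := rfl

theorem prod_leftSigns_mul {m n : ℕ} (e : Fin 2 ⊕ Fin 2 ≃ Fin 4)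
    (s : Fin 2 × Fin 2 ≃ Fin m ⊕ Fin n) (g : Signs) :
    (∏ k, leftSigns e s g k) * ∏ k, rightSigns e s g k = 1 := by
  rw [← prod_chartSigns e g, ← Equiv.prod_comp s.symm, Fintype.prod_sum_type]
  rfl

/-- Extending `δ` by 1 keeps the product 1, and product 1 is the only constraint on the characters.
-/
theorem exists_leftSigns_eq {m n : ℕ} (e : Fin 2 ⊕ Fin 2 ≃ Fin 4)
    (s : Fin 2 × Fin 2 ≃ Fin m ⊕ Fin n) {δ : Fin n → ℤˣ} (hδ : δ ∈ evenSigns n) :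
    ∃ g, leftSigns e s g = 1 ∧ rightSigns e s g = δ := by
  obtain ⟨g, hg⟩ := exists_chartSigns e (s := Sum.elim (1 : Fin m → ℤˣ) δ ∘ s) (by
    have hδ' : ∏ k, δ k = 1 := hδ
    have h1 := Equiv.prod_comp s (Sum.elim (1 : Fin m → ℤˣ) δ)
    simp only [Function.comp_apply]
    rw [h1, Fintype.prod_sum_type]
    simp [hδ'])
  refine ⟨g, ?_, ?_⟩ <;> funext k <;> simp [leftSigns, rightSigns, hg]

theorem chartSigns_eq_one_of {m n : ℕ} (e : Fin 2 ⊕ Fin 2 ≃ Fin 4)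
    (s : Fin 2 × Fin 2 ≃ Fin m ⊕ Fin n) {g : Signs} (hl : leftSigns e s g = 1)
    (hr : rightSigns e s g = 1) : chartSigns e g = 1 := by
  funext z
  obtain ⟨k, rfl⟩ := s.symm.surjective z
  rcases k with k | k
  · exact congrFun hl k
  · exact congrFun hr k

theorem eq_one_of_signVec_eq {m : ℕ} {δ : Fin m → ℤˣ} {x : EuclideanSpace ℝ (Fin m)}
    (h : signVec δ x = x) {k : Fin m} (hk : x k ≠ 0) : δ k = 1 := by
  rcases Int.units_eq_one_or (δ k) with h1 | h1
  · exact h1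
  · have h2 : ((δ k : ℤ) : ℝ) * x k = x k := congrArg (fun y => y k) h
    rw [h1] at h2
    norm_num at h2
    exact absurd (by linarith) hk

theorem exists_split {m n : ℕ} (hmn : m + n = 4) (e : Fin 2 ⊕ Fin 2 ≃ Fin 4) {p : Gr42}
    (hp : supportCard e p = m) : ∃ s : Fin 2 × Fin 2 ≃ Fin m ⊕ Fin n,
      (∀ k, (split s (chart e p)).1 k ≠ 0) ∧ (split s (chart e p)).2 = 0 := by
  classical
  set S : Fin 2 × Fin 2 → Prop := fun z => chart e p z.1 z.2 ≠ 0 with hS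
  have h1 : Fintype.card {z // S z} = m := by
    rw [Fintype.card_subtype, ← hp]
    unfold supportCard
    congr!
  have h2 : Fintype.card {z // ¬ S z} = n := by
    rw [Fintype.card_subtype_compl, h1]
    simp
    omega
  let s := (Equiv.sumCompl S).symm.trans
    (Equiv.sumCongr (Fintype.equivFinOfCardEq h1) (Fintype.equivFinOfCardEq h2))
  refine ⟨s, fun k => ?_, ?_⟩
  · exact ((Fintype.equivFinOfCardEq h1).symm k).2
  · ext k
    exact not_not.1 ((Fintype.equivFinOfCardEq h2).symm k).2

/-! ## The isotropy representation -/

/-- The action is linear in the chart, hence is its own differential. The tangent space is read off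
in the preferred chart, so `e` has to be that one. -/
theorem mfderiv_smul_apply (e : Fin 2 ⊕ Fin 2 ≃ Fin 4) {p : Gr42} (he : chartAt Model p = chart e)
    {g : Signs} (hg : g • p = p) (v : Model) :
    mfderiv 𝓘(ℝ, Model) 𝓘(ℝ, Model) (fun x : Gr42 => g • x) p v = modelAct e g v := by
  let L : Model →L[ℝ] Model := LinearMap.toContinuousLinearMap
    { toFun := modelAct e g
      map_add' := fun A B => by
        funext i j
        simp [modelAct, mul_add]
      map_smul' := fun c A => by
        funext i j
        simp only [modelAct, Pi.smul_apply, smul_eq_mul, RingHom.id_apply]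
        ring }
  have h1 : writtenInExtChartAt 𝓘(ℝ, Model) 𝓘(ℝ, Model) p (fun x : Gr42 => g • x) = L := by
    funext A
    simp only [writtenInExtChartAt, hg, extChartAt, he, mfld_simps]
    rw [smul_chart_symm, chart_chart_symm]
    rfl
  have h2 : HasMFDerivAt 𝓘(ℝ, Model) 𝓘(ℝ, Model) (fun x : Gr42 => g • x) p L := by
    refine ⟨(contMDiff_smul g).continuous.continuousAt, ?_⟩
    rw [h1]
    exact L.hasFDerivAt.hasFDerivWithinAt
  rw [h2.mfderiv]
  rfl

theorem hasIsotropyType_of_supportCard {m n : ℕ} (hmn : m + n = 4) {p : Gr42}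
    (h : ∀ e, p ∈ (chart e).source → supportCard e p = m) : HasIsotropyType m n p := by
  set e := (exists_chart p).choose
  have he : chartAt Model p = chart e := rfl
  have hpe : p ∈ (chart e).source := (exists_chart p).choose_spec
  obtain ⟨s, hs1, hs2⟩ := exists_split hmn e (h e hpe)
  have hstab : ∀ g : Signs, g • p = p ↔ leftSigns e s g = 1 := by
    intro g
    rw [smul_eq_self_iff e g hpe]
    constructor
    · intro h1
      funext k
      exact h1 _ (hs1 k)
    · intro h1 z hz
      obtain ⟨k, rfl⟩ := s.symm.surjective z
      rcases k with k | k
      · exact congrFun h1 k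
      · exact absurd (congrArg (fun y => y k) hs2) hz
  have hleft : ∀ g : MulAction.stabilizer Signs p, leftSigns e s g = 1 := fun g => (hstab _).1 g.2
  -- On the stabilizer the left signs are trivial, so the right signs alone have product 1.
  let φ : MulAction.stabilizer Signs p →* evenSigns n :=
    { toFun := fun g => ⟨rightSigns e s g, by
        have h1 := prod_leftSigns_mul e s g
        rw [hleft g] at h1
        change ∏ k, rightSigns e s g k = 1
        simpa using h1⟩
      map_one' := by
        apply Subtype.ext
        funext k
        simp [rightSigns]
      map_mul' := fun g g' => by
        apply Subtype.ext
        funext k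
        simp [rightSigns] }
  refine ⟨φ, split s, ?_, ?_, ?_⟩
  · rintro ⟨δ, hδ⟩
    obtain ⟨g, hg1, hg2⟩ := exists_leftSigns_eq e s hδ
    exact ⟨⟨g, (hstab g).2 hg1⟩, Subtype.ext hg2⟩
  · intro g
    rw [← chartSigns_eq_one_iff e]
    constructor
    · intro h1
      exact chartSigns_eq_one_of e s (hleft g) (congrArg Subtype.val h1)
    · intro h1
      apply Subtype.ext
      funext k
      exact congrFun h1 _
  · intro g v
    have h1 := mfderiv_smul_apply e he g.2 v
    refine (congrArg (split s) h1).trans ?_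
    refine (split_modelAct e s g v).trans ?_
    rw [hleft g, signVec_one]
    rfl

open FunctionalStructure

/-! ## Singular orbits -/

/-- Below 3 the truncation in `ncard_fibre` has no effect, so the fibre size fixes the number of
nonzero coordinates in every chart. -/
theorem ncard_fibre_eq {q : OrbitSpace} {k : ℕ} (hk : k < 3)
    (h : (proj ⁻¹' {q}).ncard = 2 ^ k) {p : Gr42} (hp : proj p = q) (e : Fin 2 ⊕ Fin 2 ≃ Fin 4)
    (hpe : p ∈ (chart e).source) : supportCard e p = k := by
  subst hp
  rw [ncard_fibre e hpe] at h
  have := Nat.pow_right_injective le_rfl h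
  omega

theorem prod_ite_neg_one {z z' : Fin 2 × Fin 2} (h : z ≠ z') :
    ∏ w, (if w = z ∨ w = z' then -1 else 1 : ℤˣ) = 1 := by
  revert z z'
  decide

/-- The even curve adds `t` to the coordinate `z`; the sign change at `z` and `z'` exchanges `t` and
`-t` and fixes the rest. The nonnegative function is the square of the coordinate `z`. -/
theorem isSingularPoint_of_two_zeros (e : Fin 2 ⊕ Fin 2 ≃ Fin 4) {p : Gr42}
    (hp : p ∈ (chart e).source) {z z' : Fin 2 × Fin 2} (hzz : z ≠ z')
    (hz : chart e p z.1 z.2 = 0) (hz' : chart e p z'.1 z'.2 = 0) :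
    orbitStructure.IsSingularPoint (proj p) := by
  set A := chart e p with hA
  obtain ⟨g, hg⟩ := exists_chartSigns e (prod_ite_neg_one hzz)
  set γ : ℝ → Model := fun t i j => A i j + if (i, j) = z then t else 0 with hγ
  have hγs : ContDiff ℝ ∞ γ := by
    refine contDiff_pi.2 fun i => contDiff_pi.2 fun j => ?_
    refine contDiff_const.add ?_
    split_ifs
    · exact contDiff_id
    · exact contDiff_const
  have hγe : ∀ t, modelAct e g (γ t) = γ (-t) := by
    intro t
    funext i j
    simp only [modelAct, hγ, hg]
    by_cases h1 : (i, j) = z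
    · have h2 : A i j = 0 := by
        subst h1
        exact hz
      simp [h1, h2]
    · by_cases h3 : (i, j) = z'
      · have h4 : A i j = 0 := by
          subst h3
          exact hz'
        simp [h3, h4, hzz.symm]
      · simp [h1, h3]
  have hγm : ContMDiff 𝓘(ℝ, ℝ) 𝓘(ℝ, Model) ∞ fun t => (chart e).symm (γ t) :=
    (contMDiff_chart_symm e).comp hγs.contMDiff
  let V : TopologicalSpace.Opens OrbitSpace :=
    ⟨proj '' (chart e).source, isOpenMap_proj _ (chart e).open_source⟩
  have hV : ∀ x, proj x ∈ V → x ∈ (chart e).source := by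
    rintro x ⟨y, hy, hyx⟩
    obtain ⟨g', rfl⟩ := proj_eq_iff.1 hyx
    rw [smul_eq_of_mem_source e g' hy]
    exact chart_symm_mem_source e _
  -- The square of a coordinate is invariant, so the representative chosen by `Quotient.out` does
  -- not matter.
  have hf : ∀ x ∈ (chart e).source,
      chart e (Quotient.out (proj x)) z.1 z.2 ^ 2 = chart e x z.1 z.2 ^ 2 := by
    intro x hx
    obtain ⟨g', hg'⟩ := proj_eq_iff.1 (Quotient.out_eq (proj x)).symm
    rw [← hg', smul_eq_of_mem_source e g' hx, chart_chart_symm]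
    rcases Int.units_eq_one_or (chartSigns e g' (z.1, z.2)) with h | h <;> simp [modelAct, h]
  have hfs : ContMDiffOn 𝓘(ℝ, Model) 𝓘(ℝ, ℝ) ∞ (fun x : Gr42 => chart e x z.1 z.2 ^ 2)
      (chart e).source := by
    have h1 : ContDiff ℝ ∞ fun B : Model => B z.1 z.2 ^ 2 := by fun_prop
    exact h1.contMDiff.comp_contMDiffOn
      (contMDiffOn_of_mem_maximalAtlas (chart_mem_maximalAtlas e))
  refine isSingularPoint_of_even_curve (c := fun t => proj ((chart e).symm (γ t))) (V := V)
    (f := fun q => chart e (Quotient.out q) z.1 z.2 ^ 2) ?_ ?_ ?_ ?_ ?_ ?_ ?_ ?_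
  · have h1 : γ 0 = A := by simp [hγ]
    simp only [h1]
    rw [hA, (chart e).left_inv hp]
  · exact (proj.continuous.comp hγm.continuous).continuousAt
  · intro t
    rw [eq_comm, proj_chart_symm_eq_iff]
    exact ⟨g, hγe t⟩
  · intro W f hf hW
    have h1 : ContMDiffOn 𝓘(ℝ, Model) 𝓘(ℝ, ℝ) ∞ (f ∘ proj) (proj ⁻¹' W) := hf.2
    have h2 : γ 0 = A := by simp [hγ]
    have h3 : ContMDiffAt 𝓘(ℝ, Model) 𝓘(ℝ, ℝ) ∞ (f ∘ proj) ((chart e).symm (γ 0)) := by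
      refine h1.contMDiffAt ((W.isOpen.preimage proj.continuous).mem_nhds ?_)
      rw [h2, hA, (chart e).left_inv hp]
      exact hW
    exact (h3.comp 0 hγm.contMDiffAt).contDiffAt
  · exact ⟨p, hp, rfl⟩
  · have h1 : ContMDiffOn 𝓘(ℝ, Model) 𝓘(ℝ, ℝ) ∞
        ((fun q => chart e (Quotient.out q) z.1 z.2 ^ 2) ∘ proj) (proj ⁻¹' V) :=
      (hfs.mono fun x hx => hV x hx).congr fun x hx => hf x (hV x hx)
    refine ⟨?_, h1⟩
    exact continuousOn_of_comp_isOpenMap isOpenMap_proj V.isOpen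
      (fun q _ => proj_surjective q) proj.continuous h1.continuousOn
  · intro q
    positivity
  · intro t
    rw [hf _ (chart_symm_mem_source e _), chart_chart_symm]
    have h1 : A z.1 z.2 = 0 := hz
    simp [hγ, h1]

theorem isSingularPoint_of_ncard {q : OrbitSpace} {k : ℕ} (hk : k < 3)
    (h : (proj ⁻¹' {q}).ncard = 2 ^ k) : orbitStructure.IsSingularPoint q := by
  obtain ⟨p, rfl⟩ := proj_surjective q
  obtain ⟨e, hpe⟩ := exists_chart p
  -- Writing the number of zero coordinates as `n + 2` shows that there are at least two, indexed by
  -- 0 and 1.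
  obtain ⟨n, hn⟩ : ∃ n, k + (n + 2) = 4 := ⟨2 - k, by omega⟩
  obtain ⟨s, -, hs⟩ := exists_split hn e (ncard_fibre_eq hk h rfl e hpe)
  have h1 : ∀ i, chart e p (s.symm (Sum.inr i)).1 (s.symm (Sum.inr i)).2 = 0 :=
    fun i => congrArg (fun y => y i) hs
  exact isSingularPoint_of_two_zeros e hpe
    (fun h2 => by simpa using s.symm.injective h2) (h1 0) (h1 1)

/-! ## Local models of the orbit space -/

variable {m n : ℕ}

/-- Only finitely many points `signVec δ a` differ from `a`. The factor 2 allows for two points of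
the disc of radius `r` about `a`. -/
theorem exists_radius (a : EuclideanSpace ℝ (Fin m)) :
    ∃ r : ℝ, 0 < r ∧ ∀ δ : Fin m → ℤˣ, ‖signVec δ a - a‖ < 2 * r → signVec δ a = a := by
  have h1 : ∀ᶠ r in nhdsWithin (0 : ℝ) (Set.Ioi 0),
      ∀ δ : Fin m → ℤˣ, ‖signVec δ a - a‖ < 2 * r → signVec δ a = a := by
    rw [Filter.eventually_all]
    intro δ
    by_cases h : signVec δ a = a
    · simp [h]
    · have h2 : 0 < ‖signVec δ a - a‖ / 2 := by
        have := norm_pos_iff.2 (sub_ne_zero.2 h)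
        positivity
      filter_upwards [nhdsWithin_le_nhds (Iio_mem_nhds h2)] with r hr hr'
      rw [Set.mem_Iio] at hr
      linarith
  obtain ⟨r, hr1, hr2⟩ := (h1.and self_mem_nhdsWithin).exists
  exact ⟨r, hr2, hr1⟩

/-- The points of a chart with coordinates `(a + r • v, x)`. -/
def slice (e : Fin 2 ⊕ Fin 2 ≃ Fin 4) (s : Fin 2 × Fin 2 ≃ Fin m ⊕ Fin n)
    (a : EuclideanSpace ℝ (Fin m)) (r : ℝ) (y : Disc m × EuclideanSpace ℝ (Fin n)) : Gr42 :=
  (chart e).symm ((split s).symm (a + r • y.1.1, y.2))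

theorem contMDiff_slice (e : Fin 2 ⊕ Fin 2 ≃ Fin 4) (s : Fin 2 × Fin 2 ≃ Fin m ⊕ Fin n)
    (a : EuclideanSpace ℝ (Fin m)) (r : ℝ) :
    ContMDiff (𝓘(ℝ, EuclideanSpace ℝ (Fin m)).prod 𝓘(ℝ, EuclideanSpace ℝ (Fin n)))
      𝓘(ℝ, Model) ∞ (slice e s a r) := by
  have h1 : ContDiff ℝ ∞ fun v : EuclideanSpace ℝ (Fin m) => a + r • v := by fun_prop
  have h2 : ContMDiff (𝓘(ℝ, EuclideanSpace ℝ (Fin m)).prod 𝓘(ℝ, EuclideanSpace ℝ (Fin n)))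
      𝓘(ℝ, EuclideanSpace ℝ (Fin m)) ∞
      fun y : Disc m × EuclideanSpace ℝ (Fin n) => a + r • y.1.1 :=
    h1.contMDiff.comp (contMDiff_subtype_val.comp contMDiff_fst)
  exact (contMDiff_chart_symm e).comp
    ((split s).symm.contDiff.contMDiff.comp (h2.prodMk_space contMDiff_snd))

theorem isOpenMap_slice (e : Fin 2 ⊕ Fin 2 ≃ Fin 4) (s : Fin 2 × Fin 2 ≃ Fin m ⊕ Fin n)
    (a : EuclideanSpace ℝ (Fin m)) {r : ℝ} (hr : r ≠ 0) : IsOpenMap (slice e s a r) := by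
  have h1 : IsOpenMap fun v : Disc m => a + r • v.1 :=
    (isOpenMap_add_left a).comp ((isOpenMap_smul₀ hr).comp (Disc m).isOpen.isOpenMap_subtype_val)
  exact (isOpenMap_chart_symm e).comp
    ((split s).symm.toHomeomorph.isOpenMap.comp (h1.prodMap IsOpenMap.id))

open Classical in
/-- The identity of the disc, extended by a constant. -/
def toDisc (m : ℕ) (v : EuclideanSpace ℝ (Fin m)) : Disc m :=
  if h : v ∈ Disc m then ⟨v, h⟩ else centre m

theorem toDisc_coe (v : Disc m) : toDisc m v.1 = v := by
  simp [toDisc, v.2]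

theorem contMDiffAt_toDisc (v : Disc m) : ContMDiffAt 𝓘(ℝ, EuclideanSpace ℝ (Fin m))
    𝓘(ℝ, EuclideanSpace ℝ (Fin m)) ∞ (toDisc m) v.1 := by
  rw [← contMDiffAt_subtype_iff]
  exact contMDiffAt_id.congr_of_eventuallyEq (Filter.Eventually.of_forall toDisc_coe)

/-- A local inverse of `slice`. -/
def unslice (e : Fin 2 ⊕ Fin 2 ≃ Fin 4) (s : Fin 2 × Fin 2 ≃ Fin m ⊕ Fin n)
    (a : EuclideanSpace ℝ (Fin m)) (r : ℝ) (p : Gr42) : Disc m × EuclideanSpace ℝ (Fin n) :=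
  (toDisc m (r⁻¹ • ((split s (chart e p)).1 - a)), (split s (chart e p)).2)

theorem unslice_slice (e : Fin 2 ⊕ Fin 2 ≃ Fin 4) (s : Fin 2 × Fin 2 ≃ Fin m ⊕ Fin n)
    (a : EuclideanSpace ℝ (Fin m)) {r : ℝ} (hr : r ≠ 0) (y : Disc m × EuclideanSpace ℝ (Fin n)) :
    unslice e s a r (slice e s a r y) = y := by
  simp [unslice, slice, chart_chart_symm, smul_smul, hr, toDisc_coe]

theorem contMDiffAt_unslice (e : Fin 2 ⊕ Fin 2 ≃ Fin 4) (s : Fin 2 × Fin 2 ≃ Fin m ⊕ Fin n)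
    (a : EuclideanSpace ℝ (Fin m)) {r : ℝ} (hr : r ≠ 0) (y : Disc m × EuclideanSpace ℝ (Fin n)) :
    ContMDiffAt 𝓘(ℝ, Model)
      (𝓘(ℝ, EuclideanSpace ℝ (Fin m)).prod 𝓘(ℝ, EuclideanSpace ℝ (Fin n))) ∞
      (unslice e s a r) (slice e s a r y) := by
  have h0 : ContMDiffAt 𝓘(ℝ, Model) 𝓘(ℝ, Model) ∞ (chart e) (slice e s a r y) :=
    contMDiffAt_chart e (chart_symm_mem_source e _)
  have h1 : ContDiff ℝ ∞ fun A : Model => r⁻¹ • ((split s A).1 - a) := by fun_prop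
  have h2 : ContDiff ℝ ∞ fun A : Model => (split s A).2 := by fun_prop
  refine ContMDiffAt.prodMk ?_ (h2.contMDiff.contMDiffAt.comp _ h0)
  have h3 : r⁻¹ • ((split s (chart e (slice e s a r y))).1 - a) = y.1.1 := by
    simp [slice, chart_chart_symm, smul_smul, hr]
  have h4 := contMDiffAt_toDisc y.1
  rw [← h3] at h4
  exact h4.comp (slice e s a r y) (h1.contMDiff.contMDiffAt.comp (slice e s a r y) h0)

/-- The map onto a neighbourhood of an orbit, from the product of a disc and a vector space. -/
def orbitSlice (e : Fin 2 ⊕ Fin 2 ≃ Fin 4) (s : Fin 2 × Fin 2 ≃ Fin m ⊕ Fin n)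
    (a : EuclideanSpace ℝ (Fin m)) (r : ℝ) :
    C(Disc m × EuclideanSpace ℝ (Fin n), OrbitSpace) :=
  proj.comp ⟨slice e s a r, (contMDiff_slice e s a r).continuous⟩

theorem isOpenMap_orbitSlice (e : Fin 2 ⊕ Fin 2 ≃ Fin 4) (s : Fin 2 × Fin 2 ≃ Fin m ⊕ Fin n)
    (a : EuclideanSpace ℝ (Fin m)) {r : ℝ} (hr : r ≠ 0) : IsOpenMap (orbitSlice e s a r) :=
  isOpenMap_proj.comp (isOpenMap_slice e s a hr)

/-- At a plane outside the slice, move it into the slice by some `g`; near that plane `f ∘ proj` is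
the composition of `g`, the local inverse `unslice` and the given smooth function, by invariance. -/
theorem isInducedAlong_orbitSlice (e : Fin 2 ⊕ Fin 2 ≃ Fin 4)
    (s : Fin 2 × Fin 2 ≃ Fin m ⊕ Fin n) (a : EuclideanSpace ℝ (Fin m)) {r : ℝ} (hr : r ≠ 0) :
    orbitStructure.IsInducedAlong
      (ofManifold (𝓘(ℝ, EuclideanSpace ℝ (Fin m)).prod 𝓘(ℝ, EuclideanSpace ℝ (Fin n))))
      (orbitSlice e s a r) := by
  intro V f hV
  constructor
  · rintro ⟨-, hf⟩
    exact ContMDiffOn.comp (t := proj ⁻¹' V) hf (contMDiff_slice e s a r).contMDiffOn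
      fun y hy => hy
  · intro hf
    have h1 : ContMDiffOn 𝓘(ℝ, Model) 𝓘(ℝ, ℝ) ∞ (f ∘ proj) (proj ⁻¹' V) := by
      intro p hp
      obtain ⟨y, hy⟩ := hV hp
      obtain ⟨g, hg⟩ := proj_eq_iff.1 hy.symm
      have hg' : g • p = slice e s a r y := hg
      have hyV : orbitSlice e s a r y ∈ V := by
        rw [hy]
        exact hp
      have h2 : ContMDiffAt (𝓘(ℝ, EuclideanSpace ℝ (Fin m)).prod 𝓘(ℝ, EuclideanSpace ℝ (Fin n)))
          𝓘(ℝ, ℝ) ∞ (f ∘ orbitSlice e s a r) (unslice e s a r (g • p)) := by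
        rw [hg', unslice_slice e s a hr]
        exact ContMDiffOn.contMDiffAt hf
          ((V.isOpen.preimage (orbitSlice e s a r).continuous).mem_nhds hyV)
      have h3 : ContMDiffAt 𝓘(ℝ, Model)
          (𝓘(ℝ, EuclideanSpace ℝ (Fin m)).prod 𝓘(ℝ, EuclideanSpace ℝ (Fin n))) ∞
          (fun x => unslice e s a r (g • x)) p := by
        refine ContMDiffAt.comp p (g := unslice e s a r) ?_ (contMDiff_smul g).contMDiffAt
        rw [hg']
        exact contMDiffAt_unslice e s a hr y
      have h4 := ContMDiffAt.comp p h2 h3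
      refine (h4.congr_of_eventuallyEq ?_).contMDiffWithinAt
      have h5 : ∀ᶠ x in nhds p, g • x ∈ Set.range (slice e s a r) := by
        refine (continuous_const_smul g).continuousAt.eventually_mem ?_
        rw [hg']
        exact (isOpenMap_slice e s a hr).isOpen_range.mem_nhds ⟨y, rfl⟩
      filter_upwards [h5] with x hx
      obtain ⟨y', hy'⟩ := hx
      change f (proj x) = f (proj (slice e s a r (unslice e s a r (g • x))))
      rw [← hy', unslice_slice e s a hr, hy', proj_smul]
    exact ⟨continuousOn_of_comp_isOpenMap isOpenMap_proj V.isOpen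
      (fun q _ => proj_surjective q) proj.continuous h1.continuousOn, h1⟩

theorem orbitSlice_eq_iff (e : Fin 2 ⊕ Fin 2 ≃ Fin 4) (s : Fin 2 × Fin 2 ≃ Fin m ⊕ Fin n)
    {a : EuclideanSpace ℝ (Fin m)} {r : ℝ} (hr : 0 < r)
    (hra : ∀ δ : Fin m → ℤˣ, ‖signVec δ a - a‖ < 2 * r → signVec δ a = a)
    (hstab : ∀ g, signVec (leftSigns e s g) a = a → leftSigns e s g = 1)
    (y y' : Disc m × EuclideanSpace ℝ (Fin n)) :
    orbitSlice e s a r y = orbitSlice e s a r y' ↔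
      y.1 = y'.1 ∧ ∃ δ : evenSigns n, signVec δ.1 y'.2 = y.2 := by
  have h1 : orbitSlice e s a r y = orbitSlice e s a r y' ↔
      ∃ g, signVec (leftSigns e s g) (a + r • y'.1.1) = a + r • y.1.1 ∧
        signVec (rightSigns e s g) y'.2 = y.2 := by
    rw [eq_comm]
    refine (proj_chart_symm_eq_iff e).trans (exists_congr fun g => ?_)
    rw [← (split s).injective.eq_iff, split_modelAct, ContinuousLinearEquiv.apply_symm_apply,
      ContinuousLinearEquiv.apply_symm_apply, Prod.mk.injEq]
  rw [h1]
  constructor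
  · rintro ⟨g, hg1, hg2⟩
    have h2 : leftSigns e s g = 1 := by
      -- If `g` maps one point of the disc about `a` to another, it moves `a` by less than `2 * r`,
      -- hence fixes `a`.
      refine hstab g (hra _ ?_)
      rw [signVec_add, signVec_smul] at hg1
      have h3 : signVec (leftSigns e s g) a - a =
          r • (y.1.1 - signVec (leftSigns e s g) y'.1.1) := by
        rw [smul_sub, sub_eq_sub_iff_add_eq_add, hg1, add_comm]
      have h4 : ‖y.1.1‖ < 1 := mem_ball_zero_iff.1 y.1.2
      have h5 : ‖y'.1.1‖ < 1 := mem_ball_zero_iff.1 y'.1.2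
      rw [h3, norm_smul, Real.norm_of_nonneg hr.le, mul_comm]
      refine mul_lt_mul_of_pos_right ((norm_sub_le _ _).trans_lt ?_) hr
      rw [norm_signVec]
      linarith
    refine ⟨?_, ⟨rightSigns e s g, ?_⟩, hg2⟩
    · rw [h2, signVec_one] at hg1
      exact Subtype.ext (smul_right_injective _ hr.ne' (add_left_cancel hg1)).symm
    · have h6 := prod_leftSigns_mul e s g
      rw [h2] at h6
      change ∏ k, rightSigns e s g k = 1
      simpa using h6
  · rintro ⟨h2, δ, hδ⟩
    obtain ⟨g, hg1, hg2⟩ := exists_leftSigns_eq e s δ.2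
    exact ⟨g, by rw [hg1, signVec_one, h2], by rw [hg2, hδ]⟩

theorem orbitSlice_centre (e : Fin 2 ⊕ Fin 2 ≃ Fin 4) (s : Fin 2 × Fin 2 ≃ Fin m ⊕ Fin n)
    {p : Gr42} (hp : p ∈ (chart e).source) (h : (split s (chart e p)).2 = 0) (r : ℝ) :
    orbitSlice e s (split s (chart e p)).1 r (centre m, 0) = proj p := by
  change proj (slice _ _ _ _ _) = _
  have h1 : ((split s (chart e p)).1, (0 : EuclideanSpace ℝ (Fin n))) = split s (chart e p) :=
    Prod.ext rfl h.symm
  simp [slice, centre, h1, (chart e).left_inv hp]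

/-- An orbit has a neighbourhood of the form `Y`, if `Y` is the quotient of the product of the disc
and a vector space by the stabilizer. -/
theorem exists_isLocalIso (hmn : m + n = 4) {q : OrbitSpace} {k : ℕ} (hk : k < 3) (hkm : k = m)
    (hq : (proj ⁻¹' {q}).ncard = 2 ^ k) {Y : Type} [TopologicalSpace Y]
    {G : FunctionalStructure Y} {b : C(Disc m × EuclideanSpace ℝ (Fin n), Y)} (hb : IsOpenMap b)
    (hbs : Function.Surjective b)
    (hbf : ∀ y y', b y = b y' ↔ y.1 = y'.1 ∧ ∃ δ : evenSigns n, signVec δ.1 y'.2 = y.2)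
    (hG : G.IsInducedAlong
      (ofManifold (𝓘(ℝ, EuclideanSpace ℝ (Fin m)).prod 𝓘(ℝ, EuclideanSpace ℝ (Fin n)))) b) :
    orbitStructure.HasNeighbourhoodOfForm q G (b (centre m, 0)) := by
  subst hkm
  obtain ⟨p, rfl⟩ := proj_surjective q
  obtain ⟨e, hpe⟩ := exists_chart p
  obtain ⟨s, hs1, hs2⟩ := exists_split hmn e (ncard_fibre_eq hk hq rfl e hpe)
  set a := (split s (chart e p)).1
  obtain ⟨r, hr, hra⟩ := exists_radius a
  have : Nonempty (Disc k × EuclideanSpace ℝ (Fin n)) := ⟨(centre k, 0)⟩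
  have hab : ∀ y y', orbitSlice e s a r y = orbitSlice e s a r y' ↔ b y = b y' := fun y y' => by
    rw [hbf, orbitSlice_eq_iff e s hr hra]
    intro g hg
    funext i
    -- All coordinates of `a` are nonzero, so signs that fix `a` are trivial.
    exact eq_one_of_signVec_eq hg (hs1 i)
  have hp := orbitSlice_centre e s hpe hs2 r
  refine ⟨homeoOfSameFibres _ _ (isOpenMap_orbitSlice e s a hr.ne') hb hab,
    ⟨_, hp⟩, hbs.range_eq, ?_,
    isLocalIso_homeoOfSameFibres _ hb hab (isInducedAlong_orbitSlice e s a hr.ne') hG⟩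
  rw [← hp]
  exact homeoOfSameFibres_apply _ _ (isOpenMap_orbitSlice e s a hr.ne') hb hab _

theorem hasNeighbourhoodOfForm_discCone [NeZero n] (hmn : m + n = 4) {q : OrbitSpace} (hm : m < 3)
    (hq : (proj ⁻¹' {q}).ncard = 2 ^ m) :
    orbitStructure.HasNeighbourhoodOfForm q (discConeStructure m n) (centre m, apex n) := by
  have hb : IsOpenMap ((ContinuousMap.id (Disc m)).prodMap (coneMap n)) :=
    IsOpenMap.id.prodMap (isOpenMap_coneMap n)
  have h1 := exists_isLocalIso hmn hm rfl hq (G := discConeStructure m n) hb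
    (Function.surjective_id.prodMap (coneMap_surjective n)) ?_ (isInducedAlong_pushforward _ hb)
  · have h2 : (ContinuousMap.id (Disc m)).prodMap (coneMap n) (centre m, 0) =
        (centre m, apex n) := Prod.ext rfl (coneMap_zero n)
    rwa [h2] at h1
  · intro y y'
    rw [← coneMap_eq_iff]
    exact Prod.ext_iff

/-- The disc `D⁰` is a point; the second projection and the section through the centre transfer
smoothness between `D⁰ × ℝ⁴` and `ℝ⁴`. -/
theorem hasNeighbourhoodOfForm_cone {q : OrbitSpace} (hq : (proj ⁻¹' {q}).ncard = 1) :
    orbitStructure.HasNeighbourhoodOfForm q (coneStructure 4) (apex 4) := by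
  have hsub : ∀ v v' : Disc 0, v = v' := fun v v' => Subtype.ext (Subsingleton.elim _ _)
  have hb : IsOpenMap ((coneMap 4).comp (ContinuousMap.snd (α := Disc 0))) :=
    (isOpenMap_coneMap 4).comp isOpenMap_snd
  have h1 := exists_isLocalIso (m := 0) (n := 4) rfl (by norm_num) rfl hq (G := coneStructure 4) hb
    ((coneMap_surjective 4).comp fun x => ⟨(centre 0, x), rfl⟩) ?_ ?_
  · rw [← coneMap_zero]
    exact h1
  · intro y y'
    rw [← coneMap_eq_iff]
    simp [hsub y.1 y'.1]
  · intro V f _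
    refine (isInducedAlong_pushforward _ (isOpenMap_coneMap 4) V f
      fun w _ => coneMap_surjective 4 w).trans ?_
    constructor
    · intro h
      exact ContMDiffOn.comp (t := coneMap 4 ⁻¹' V) h contMDiff_snd.contMDiffOn fun y hy => hy
    · intro h
      exact ContMDiffOn.comp h (f := fun x => (centre 0, x))
        (contMDiff_const.prodMk contMDiff_id).contMDiffOn fun y hy => hy

/-! ### Smooth points of the orbit space -/

/-- At most one character is left undetermined, and the product relation makes it trivial. -/
theorem chartSigns_eq_one_of_supportCard (e : Fin 2 ⊕ Fin 2 ≃ Fin 4) {p : Gr42}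
    (hp : 3 ≤ supportCard e p) {g : Signs}
    (hg : ∀ z : Fin 2 × Fin 2, chart e p z.1 z.2 ≠ 0 → chartSigns e g z = 1) :
    chartSigns e g = 1 := by
  classical
  by_contra h
  obtain ⟨z, hz⟩ : ∃ z, chartSigns e g z ≠ 1 := by
    by_contra! h1
    exact h (funext h1)
  have hz0 : chart e p z.1 z.2 = 0 := by
    by_contra h1
    exact hz (hg z h1)
  have h1 : ∀ w, w ≠ z → chartSigns e g w = 1 := by
    intro w hw
    refine hg w fun hw0 => ?_
    have h2 : (Finset.univ.filter fun z : Fin 2 × Fin 2 => chart e p z.1 z.2 ≠ 0) ⊆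
        Finset.univ \ {z, w} := by
      intro u hu
      simp only [Finset.mem_filter, Finset.mem_univ, true_and] at hu
      simp only [Finset.mem_sdiff, Finset.mem_univ, true_and, Finset.mem_insert,
        Finset.mem_singleton]
      rintro (rfl | rfl)
      · exact hu hz0
      · exact hu hw0
    have h3 := Finset.card_le_card h2
    rw [Finset.card_univ_sdiff, Finset.card_pair hw.symm] at h3
    have h4 : supportCard e p ≤ 2 := by
      unfold supportCard
      convert h3 using 1
      congr!
    omega
  have h5 := prod_chartSigns e g
  rw [Finset.prod_eq_single z (fun w _ hw => h1 w hw) (by simp)] at h5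
  exact hz h5

theorem isSmoothPoint_of_ncard {q : OrbitSpace} (hq : (proj ⁻¹' {q}).ncard = 2 ^ 3) :
    orbitStructure.IsSmoothPoint 4 q := by
  obtain ⟨p, rfl⟩ := proj_surjective q
  obtain ⟨e, hpe⟩ := exists_chart p
  rw [ncard_fibre e hpe] at hq
  have hk : 3 ≤ supportCard e p := by
    have := Nat.pow_right_injective le_rfl hq
    omega
  -- All four coordinates go into the disc, in any order, including one that may vanish; the
  -- stabilizer acts trivially on them anyway.
  let s : Fin 2 × Fin 2 ≃ Fin 4 ⊕ Fin 0 :=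
    (Fintype.equivFinOfCardEq (by simp)).trans (Equiv.sumEmpty (Fin 4) (Fin 0)).symm
  set a := (split s (chart e p)).1
  obtain ⟨r, hr, hra⟩ := exists_radius a
  let b : C(Disc 4 × EuclideanSpace ℝ (Fin 0), EuclideanSpace ℝ (Fin 4)) :=
    ⟨fun y => y.1.1, by fun_prop⟩
  have hb : IsOpenMap b := (Disc 4).isOpen.isOpenMap_subtype_val.comp isOpenMap_fst
  have : Nonempty (Disc 4 × EuclideanSpace ℝ (Fin 0)) := ⟨(centre 4, 0)⟩
  have hab : ∀ y y', orbitSlice e s a r y = orbitSlice e s a r y' ↔ b y = b y' := fun y y' => by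
    rw [orbitSlice_eq_iff e s hr hra]
    · change _ ↔ y.1.1 = y'.1.1
      rw [← Subtype.ext_iff]
      exact ⟨fun h => h.1, fun h => ⟨h, 1, Subsingleton.elim _ _⟩⟩
    · intro g hg
      have h1 : chartSigns e g = 1 := by
        refine chartSigns_eq_one_of_supportCard e hk fun z hz => ?_
        obtain ⟨i, rfl⟩ := s.symm.surjective z
        rcases i with i | i
        · exact eq_one_of_signVec_eq hg hz
        · exact i.elim0
      funext i
      exact congrFun h1 _
  have hp := orbitSlice_centre e s hpe (Subsingleton.elim _ _) r
  refine ⟨homeoOfSameFibres _ _ (isOpenMap_orbitSlice e s a hr.ne') hb hab, ⟨_, hp⟩,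
    isLocalIso_homeoOfSameFibres _ hb hab (isInducedAlong_orbitSlice e s a hr.ne') ?_⟩
  intro V f hV
  constructor
  · intro h
    have h1 : ContMDiffOn 𝓘(ℝ, EuclideanSpace ℝ (Fin 4)) 𝓘(ℝ, ℝ) ∞ f V := h
    have h2 : ContMDiff (𝓘(ℝ, EuclideanSpace ℝ (Fin 4)).prod 𝓘(ℝ, EuclideanSpace ℝ (Fin 0)))
        𝓘(ℝ, EuclideanSpace ℝ (Fin 4)) ∞ b := contMDiff_subtype_val.comp contMDiff_fst
    exact h1.comp h2.contMDiffOn fun y hy => hy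
  · intro h x hx
    obtain ⟨y, rfl⟩ := hV hx
    have h1 : ContMDiffAt _ 𝓘(ℝ, ℝ) ∞ (f ∘ b) y :=
      ContMDiffOn.contMDiffAt h ((V.isOpen.preimage b.continuous).mem_nhds hx)
    have h2 : ContMDiffAt 𝓘(ℝ, EuclideanSpace ℝ (Fin 4))
        (𝓘(ℝ, EuclideanSpace ℝ (Fin 4)).prod 𝓘(ℝ, EuclideanSpace ℝ (Fin 0))) ∞
        (fun v => (toDisc 4 v, (0 : EuclideanSpace ℝ (Fin 0)))) (b y) :=
      (contMDiffAt_toDisc y.1).prodMk contMDiffAt_const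
    have h3 : (fun v => (toDisc 4 v, (0 : EuclideanSpace ℝ (Fin 0)))) (b y) = y :=
      Prod.ext (toDisc_coe y.1) (Subsingleton.elim _ _)
    rw [← h3] at h1
    refine ((ContMDiffAt.comp (b y) h1 h2).congr_of_eventuallyEq ?_).contMDiffWithinAt
    filter_upwards [(Disc 4).isOpen.mem_nhds y.1.2] with v hv
    change f v = f (toDisc 4 v).1
    rw [toDisc_coe ⟨v, hv⟩]

end Gr42

end

theorem mainTheorem8 :
    -- the possible sizes of the fibres of the projection
    (∀ q : Gr42.OrbitSpace, ∃ k ≤ 3, (Gr42.proj ⁻¹' {q}).ncard = 2 ^ k) ∧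
    -- orbits of maximal size
    (∀ q : Gr42.OrbitSpace, (Gr42.proj ⁻¹' {q}).ncard = 2 ^ 3 →
      Gr42.orbitStructure.IsSmoothPoint 4 q) ∧
    -- orbits with four points
    (∀ q : Gr42.OrbitSpace, (Gr42.proj ⁻¹' {q}).ncard = 2 ^ 2 →
      Gr42.orbitStructure.IsSingularPoint q ∧
      Gr42.orbitStructure.HasNeighbourhoodOfForm q
        (Gr42.discConeStructure 2 2) (Gr42.centre 2, Gr42.apex 2) ∧
      ∀ p : Gr42, Gr42.proj p = q → Gr42.HasIsotropyType 2 2 p) ∧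
    -- orbits with two points
    (∀ q : Gr42.OrbitSpace, (Gr42.proj ⁻¹' {q}).ncard = 2 →
      Gr42.orbitStructure.IsSingularPoint q ∧
      Gr42.orbitStructure.HasNeighbourhoodOfForm q
        (Gr42.discConeStructure 1 3) (Gr42.centre 1, Gr42.apex 3) ∧
      ∀ p : Gr42, Gr42.proj p = q → Gr42.HasIsotropyType 1 3 p) ∧
    -- fixed points
    (∀ q : Gr42.OrbitSpace, (Gr42.proj ⁻¹' {q}).ncard = 1 →
      Gr42.orbitStructure.IsSingularPoint q ∧
      Gr42.orbitStructure.HasNeighbourhoodOfForm q (Gr42.coneStructure 4) (Gr42.apex 4) ∧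
      ∀ p : Gr42, Gr42.proj p = q → Gr42.HasIsotropyType 0 4 p) ∧
    -- the actions on the two spheres have no fixed points
    (∀ x : Gr42.UnitSphere 3, ∃ g : Gr42.evenSigns 3, g • x ≠ x) ∧
    (∀ x : Gr42.UnitSphere 4, ∃ g : Gr42.evenSigns 4, g • x ≠ x) ∧
    -- the projection induces no smooth structure on the orbit space, i.e. on the 4-sphere: for no
    -- smooth manifold N homeomorphic to it is the projection a smooth map inducing the structure of N
    (∀ (d : ℕ) (N : Type) [TopologicalSpace N] [ChartedSpace (EuclideanSpace ℝ (Fin d)) N]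
      [IsManifold 𝓘(ℝ, EuclideanSpace ℝ (Fin d)) ∞ N] (h : Gr42.OrbitSpace ≃ₜ N),
      ¬ Gr42.InducesSmoothStructure 𝓘(ℝ, Gr42.Model) 𝓘(ℝ, EuclideanSpace ℝ (Fin d))
        (h ∘ Gr42.proj)) := by
  refine ⟨?_, fun q hq => Gr42.isSmoothPoint_of_ncard hq, ?_, ?_, ?_, ?_, ?_, ?_⟩
  · intro q
    obtain ⟨p, rfl⟩ := Gr42.proj_surjective q
    obtain ⟨e, he⟩ := Gr42.exists_chart p
    exact ⟨_, min_le_right _ _, Gr42.ncard_fibre e he⟩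
  · intro q hq
    exact ⟨Gr42.isSingularPoint_of_ncard (by norm_num) hq,
      Gr42.hasNeighbourhoodOfForm_discCone rfl (by norm_num) hq,
      fun p hp => Gr42.hasIsotropyType_of_supportCard rfl
        (Gr42.ncard_fibre_eq (by norm_num) hq hp)⟩
  · intro q hq
    rw [← pow_one 2] at hq
    exact ⟨Gr42.isSingularPoint_of_ncard (by norm_num) hq,
      Gr42.hasNeighbourhoodOfForm_discCone rfl (by norm_num) hq,
      fun p hp => Gr42.hasIsotropyType_of_supportCard rfl
        (Gr42.ncard_fibre_eq (by norm_num) hq hp)⟩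
  · intro q hq
    have hq' := hq
    rw [← pow_zero 2] at hq'
    exact ⟨Gr42.isSingularPoint_of_ncard (by norm_num) hq', Gr42.hasNeighbourhoodOfForm_cone hq,
      fun p hp => Gr42.hasIsotropyType_of_supportCard rfl
        (Gr42.ncard_fibre_eq (by norm_num) hq' hp)⟩
  · exact Gr42.exists_smul_ne (by decide)
  · exact Gr42.exists_smul_ne (by decide)
  · intro d N _ _ _ h hh
    -- The matrix 0 represents a coordinate plane, with all chart coordinates zero; any two of them
    -- serve.
    let e : Fin 2 ⊕ Fin 2 ≃ Fin 4 := finSumFinEquiv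
    refine Gr42.isSingularPoint_of_two_zeros e (Gr42.chart_symm_mem_source e 0)
      (z := (0, 0)) (z' := (0, 1)) (by decide) ?_ ?_ d
      (Gr42.isSmoothPoint_of_inducesSmoothStructure h hh _) <;>
    rw [Gr42.chart_chart_symm] <;> rfl
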